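/- Let $N\in\mathbb N$ and let $p$ be real with $1<p<N$; put $p^*=\frac{pN}{N-p}$ and let $p\le q\le p^*$. Let $W^{1,p}(\mathbb R^N)$ be the Sobolev space of real functions $u\in L^p(\mathbb R^N)$ with weak gradient $\nabla u\in L^p(\mathbb R^N;\mathbb R^N)$, normed by $(\|u\|_p^p+\|\nabla u\|_p^p)^{1/p}$, and let $$D=\{u\mapsto u(\cdot-y)\;:\;y\in\mathbb Z^N\}.$$ Say that a sequence $(u_k)$ in $W^{1,p}(\mathbb R^N)$ converges to zero $D$-weakly if $u_k(\cdot-y_k)\rightharpoonup 0$ weakly in $W^{1,p}(\mathbb R^N)$ for every choice of a sequence $(y_k)$ in $\mathbb Z^N$. Then $D$ is a bounded set of bounded linear operators on $W^{1,p}(\mathbb R^N)$ that contains the identity, $W^{1,p}(\mathbb R^N)$ is continuously imbedded into $L^q(\mathbb R^N)$, and: 1. The imbedding $W^{1,p}(\mathbb R^N)\hookrightarrow L^q(\mathbb R^N)$ is cocompact relative to $D$, that is, every sequence $(u_k)$ in $W^{1,p}(\mathbb R^N)$ that converges to zero $D$-weakly satisfies $\|u_k\|_{L^q}\to0$, unless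 $q=p$ or $q=p^*$; in these two cases the imbedding is not cocompact relative to $D$. 2. If $p<q<p^*$, then the $L^q$-norm gives a local metrization of the $D$-weak convergence: for every bounded sequence $(u_k)$ in $W^{1,p}(\mathbb R^N)$, $(u_k)$ converges to zero $D$-weakly if and only if $\|u_k\|_{L^q}\to0$. -/

import Mathlib

open MeasureTheory Filter Topology
open scoped NNReal ENNReal ContDiff

section GaugedWeakConvergence

variable {X : Type*} [NormedAddCommGroup X] [NormedSpace ℝ X] [CompleteSpace X]
variable {Y : Type*} [NormedAddCommGroup Y] [NormedSpace ℝ Y] [CompleteSpace Y]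

/-- An admissible set of gauges on the Banach space `X`: a (norm-)bounded set of bounded linear
operators that contains the identity. -/
structure IsGaugeSet (D : Set (X →L[ℝ] X)) : Prop where
  isBounded : Bornology.IsBounded D
  id_mem : ContinuousLinearMap.id ℝ X ∈ D

/-- `D`-weak convergence to zero: `g k (u k) ⇀ 0` weakly in `X` for every choice of a sequence
`g` in `D`. -/
def GaugeWeakToZero (D : Set (X →L[ℝ] X)) (u : ℕ → X) : Prop :=
  ∀ g : ℕ → X →L[ℝ] X, (∀ k, g k ∈ D) →
    Tendsto (fun k => toWeakSpace ℝ X (g k (u k))) atTop (𝓝 0)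

/-- The continuous imbedding `ι` of `X` into `Y` is cocompact relative to `D`: every sequence
that is `D`-weakly convergent to zero in `X` converges to zero in the norm of `Y`. -/
def IsCocompactImbedding (D : Set (X →L[ℝ] X)) (ι : X →L[ℝ] Y) : Prop :=
  ∀ u : ℕ → X, GaugeWeakToZero D u → Tendsto (fun k => ‖ι (u k)‖) atTop (𝓝 0)

/-- The norm of `Y` provides a local metrization of the `D`-weak convergence on `X`: on bounded
sequences of `X`, the `D`-weak convergence to zero is the convergence to zero in the norm
of `Y`. -/
def IsLocalMetrization (D : Set (X →L[ℝ] X)) (ι : X →L[ℝ] Y) : Prop :=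
  ∀ u : ℕ → X, Bornology.IsBounded (Set.range u) →
    (GaugeWeakToZero D u ↔ Tendsto (fun k => ‖ι (u k)‖) atTop (𝓝 0))

end GaugedWeakConvergence

/-- `g` is the weak (distributional) gradient of `u` on `ℝ^N`: integration by parts holds against
every test function in `C_c^∞(ℝ^N)`. -/
def IsWeakGradient (N : ℕ) (u : EuclideanSpace ℝ (Fin N) → ℝ)
    (g : EuclideanSpace ℝ (Fin N) → EuclideanSpace ℝ (Fin N)) : Prop :=
  ∀ φ : EuclideanSpace ℝ (Fin N) → ℝ, ContDiff ℝ ∞ φ → HasCompactSupport φ →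
    ∀ i : Fin N,
      ∫ x, u x * fderiv ℝ φ x (EuclideanSpace.single i 1) = -∫ x, g x i * φ x

/-- The space of pairs `(u, g)` with `u ∈ L^p(ℝ^N)` and `g ∈ L^p(ℝ^N; ℝ^N)`, with the norm
`(‖u‖_p ^ p + ‖g‖_p ^ p) ^ (1 / p)`. -/
abbrev SobolevAmbient (N : ℕ) (p : ℝ≥0∞) : Type :=
  WithLp p (Lp ℝ p (volume : Measure (EuclideanSpace ℝ (Fin N))) ×
    Lp (EuclideanSpace ℝ (Fin N)) p (volume : Measure (EuclideanSpace ℝ (Fin N))))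

section SobolevSpace

variable {N : ℕ} {p : ℝ≥0∞} [hp : Fact (1 ≤ p)]

theorem integrable_lp_mul_test {F : Type*} [NormedAddCommGroup F] [NormedSpace ℝ F]
    (L : F →L[ℝ] ℝ) (u : Lp F p (volume : Measure (EuclideanSpace ℝ (Fin N))))
    {φ : EuclideanSpace ℝ (Fin N) → ℝ} (hc : Continuous φ) (hs : HasCompactSupport φ) :
    Integrable (fun x => L (u x) * φ x) := by
  have hloc : LocallyIntegrable (fun x => u x) (volume : Measure (EuclideanSpace ℝ (Fin N))) :=
    (Lp.memLp u).locallyIntegrable hp.out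
  have h := L.integrable_comp (hloc.integrable_smul_left_of_hasCompactSupport hc hs)
  refine h.congr (Eventually.of_forall fun x => ?_)
  simp [mul_comm]

theorem continuous_integral_lp_mul_test {F : Type*} [NormedAddCommGroup F] [NormedSpace ℝ F]
    (L : F →L[ℝ] ℝ) {φ : EuclideanSpace ℝ (Fin N) → ℝ} (hc : Continuous φ)
    (hs : HasCompactSupport φ) :
    Continuous fun u : Lp F p (volume : Measure (EuclideanSpace ℝ (Fin N))) =>
      ∫ x, L (u x) * φ x := by
  have hφ : MemLp φ (ENNReal.conjExponent p) (volume : Measure (EuclideanSpace ℝ (Fin N))) :=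
    hc.memLp_of_hasCompactSupport hs
  have : Fact (1 ≤ ENNReal.conjExponent p) := ⟨by simp [ENNReal.conjExponent]⟩
  let B : F →L[ℝ] ℝ →L[ℝ] ℝ := (ContinuousLinearMap.mul ℝ ℝ).comp L
  have h : Continuous fun u : Lp F p (volume : Measure (EuclideanSpace ℝ (Fin N))) =>
      B.lpPairing volume p (ENNReal.conjExponent p) u (hφ.toLp φ) := by fun_prop
  refine h.congr fun u => ?_
  rw [ContinuousLinearMap.lpPairing_eq_integral]
  refine integral_congr_ae ?_
  filter_upwards [hφ.coeFn_toLp] with x hx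
  simp [B, hx]

theorem continuous_test_deriv {φ : EuclideanSpace ℝ (Fin N) → ℝ} (hφ : ContDiff ℝ ∞ φ)
    (v : EuclideanSpace ℝ (Fin N)) : Continuous fun x => fderiv ℝ φ x v :=
  (hφ.continuous_fderiv (by simp)).clm_apply continuous_const

theorem isWeakGradient_iff_coord {N : ℕ} {p : ℝ≥0∞} (w : SobolevAmbient N p) :
    IsWeakGradient N w.fst w.snd ↔
      ∀ φ : EuclideanSpace ℝ (Fin N) → ℝ, ContDiff ℝ ∞ φ → HasCompactSupport φ → ∀ i : Fin N,
        (∫ x, ContinuousLinearMap.id ℝ ℝ (w.fst x) * fderiv ℝ φ x (EuclideanSpace.single i 1)) +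
          ∫ x, EuclideanSpace.proj (𝕜 := ℝ) i (w.snd x) * φ x = 0 := by
  refine forall_congr' fun φ => forall_congr' fun _ => forall_congr' fun _ =>
    forall_congr' fun i => ?_
  rw [← eq_neg_iff_add_eq_zero]
  rfl

variable (N p)

/-- The Sobolev space `W^{1,p}(ℝ^N)` of real functions: the pairs `(u, ∇u)` with `u ∈ L^p(ℝ^N)` whose
weak gradient `∇u` belongs to `L^p(ℝ^N; ℝ^N)`. The ambient `ℓ^p` product gives it the norm
`(‖u‖_p ^ p + ‖∇u‖_p ^ p) ^ (1 / p)`. -/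
def SobolevW1 : Submodule ℝ (SobolevAmbient N p) where
  carrier := {w | IsWeakGradient N w.fst w.snd}
  zero_mem' := by
    rw [Set.mem_ofPred_eq, isWeakGradient_iff_coord]
    intro φ _ _ i
    rw [integral_eq_zero_of_ae, integral_eq_zero_of_ae, add_zero]
    · exact Eventually.of_forall fun x => by simp
    · exact Eventually.of_forall fun x => by simp
  add_mem' := by
    intro a b ha hb
    rw [Set.mem_ofPred_eq, isWeakGradient_iff_coord] at ha hb ⊢
    intro φ hφ hs i
    have hc' := continuous_test_deriv hφ (EuclideanSpace.single i 1)
    have hs' : HasCompactSupport fun x => fderiv ℝ φ x (EuclideanSpace.single i 1) :=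
      hs.fderiv_apply (𝕜 := ℝ) _
    have e1 : ∫ x, ContinuousLinearMap.id ℝ ℝ ((a + b).fst x) *
          fderiv ℝ φ x (EuclideanSpace.single i 1) =
        (∫ x, ContinuousLinearMap.id ℝ ℝ (a.fst x) * fderiv ℝ φ x (EuclideanSpace.single i 1)) +
        ∫ x, ContinuousLinearMap.id ℝ ℝ (b.fst x) * fderiv ℝ φ x (EuclideanSpace.single i 1) := by
      rw [← integral_add (integrable_lp_mul_test _ a.fst hc' hs')
        (integrable_lp_mul_test _ b.fst hc' hs')]
      refine integral_congr_ae ?_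
      filter_upwards [Lp.coeFn_add a.fst b.fst] with x hx
      rw [WithLp.add_fst, hx, Pi.add_apply, map_add, add_mul]
    have e2 : ∫ x, EuclideanSpace.proj (𝕜 := ℝ) i ((a + b).snd x) * φ x =
        (∫ x, EuclideanSpace.proj (𝕜 := ℝ) i (a.snd x) * φ x) +
        ∫ x, EuclideanSpace.proj (𝕜 := ℝ) i (b.snd x) * φ x := by
      rw [← integral_add (integrable_lp_mul_test _ a.snd hφ.continuous hs)
        (integrable_lp_mul_test _ b.snd hφ.continuous hs)]
      refine integral_congr_ae ?_
      filter_upwards [Lp.coeFn_add a.snd b.snd] with x hx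
      rw [WithLp.add_snd, hx, Pi.add_apply, map_add, add_mul]
    rw [e1, e2]
    linarith [ha φ hφ hs i, hb φ hφ hs i]
  smul_mem' := by
    intro c a ha
    rw [Set.mem_ofPred_eq, isWeakGradient_iff_coord] at ha ⊢
    intro φ hφ hs i
    have e1 : ∫ x, ContinuousLinearMap.id ℝ ℝ ((c • a).fst x) *
          fderiv ℝ φ x (EuclideanSpace.single i 1) =
        c * ∫ x, ContinuousLinearMap.id ℝ ℝ (a.fst x) *
          fderiv ℝ φ x (EuclideanSpace.single i 1) := by
      rw [← integral_const_mul]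
      refine integral_congr_ae ?_
      filter_upwards [Lp.coeFn_smul c a.fst] with x hx
      rw [WithLp.smul_fst, hx, Pi.smul_apply, map_smul, smul_eq_mul, mul_assoc]
    have e2 : ∫ x, EuclideanSpace.proj (𝕜 := ℝ) i ((c • a).snd x) * φ x =
        c * ∫ x, EuclideanSpace.proj (𝕜 := ℝ) i (a.snd x) * φ x := by
      rw [← integral_const_mul]
      refine integral_congr_ae ?_
      filter_upwards [Lp.coeFn_smul c a.snd] with x hx
      rw [WithLp.smul_snd, hx, Pi.smul_apply, map_smul, smul_eq_mul, mul_assoc]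
    rw [e1, e2, ← mul_add, ha φ hφ hs i, mul_zero]

theorem isClosed_sobolevW1 : IsClosed (SobolevW1 N p : Set (SobolevAmbient N p)) := by
  have : (SobolevW1 N p : Set (SobolevAmbient N p)) =
      {w | IsWeakGradient N w.fst w.snd} := rfl
  rw [this]
  simp only [isWeakGradient_iff_coord, Set.ofPred_forall]
  refine isClosed_iInter fun φ => isClosed_iInter fun hφ => isClosed_iInter fun hs =>
    isClosed_iInter fun i => ?_
  refine isClosed_eq (Continuous.add ?_ ?_) continuous_const
  · exact (continuous_integral_lp_mul_test _ (continuous_test_deriv hφ _)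
      (hs.fderiv_apply (𝕜 := ℝ) _)).comp (WithLp.continuous_fst p _ _)
  · exact (continuous_integral_lp_mul_test _ hφ.continuous hs).comp (WithLp.continuous_snd p _ _)

instance : CompleteSpace (SobolevW1 N p) :=
  (isClosed_sobolevW1 N p).completeSpace_coe

variable {N p}

/-- The function underlying an element of `W^{1,p}(ℝ^N)`, as an element of `L^p(ℝ^N)`. -/
def sobolevFun (u : SobolevW1 N p) : Lp ℝ p (volume : Measure (EuclideanSpace ℝ (Fin N))) :=
  (u : SobolevAmbient N p).fst

/-- The weak gradient of an element of `W^{1,p}(ℝ^N)`. -/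
def sobolevGrad (u : SobolevW1 N p) :
    Lp (EuclideanSpace ℝ (Fin N)) p (volume : Measure (EuclideanSpace ℝ (Fin N))) :=
  (u : SobolevAmbient N p).snd

/-- The point of `ℝ^N` with the integer coordinates `y`. -/
def latticePoint (y : Fin N → ℤ) : EuclideanSpace ℝ (Fin N) :=
  WithLp.toLp 2 fun i => (y i : ℝ)

theorem isWeakGradient_shift {u : EuclideanSpace ℝ (Fin N) → ℝ}
    {g : EuclideanSpace ℝ (Fin N) → EuclideanSpace ℝ (Fin N)} (h : IsWeakGradient N u g)
    (a : EuclideanSpace ℝ (Fin N)) :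
    IsWeakGradient N (fun x => u (x - a)) (fun x => g (x - a)) := by
  intro φ hφ hs i
  have h1 := h (fun x => φ (x + a)) (hφ.comp (contDiff_id.add contDiff_const))
    (hs.comp_homeomorph (Homeomorph.addRight a)) i
  simp only [fderiv_comp_add_right] at h1
  rw [← integral_sub_right_eq_self _ a, ← integral_sub_right_eq_self (fun x => g x i * _) a] at h1
  simpa using h1

variable (p)

/-- The shift `u ↦ u(· - y)` of `L^p(ℝ^N; F)` by the lattice vector `y`. -/
noncomputable def lpShift (F : Type*) [NormedAddCommGroup F] [NormedSpace ℝ F] (y : Fin N → ℤ) :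
    Lp F p (volume : Measure (EuclideanSpace ℝ (Fin N))) →ₗᵢ[ℝ]
      Lp F p (volume : Measure (EuclideanSpace ℝ (Fin N))) :=
  Lp.compMeasurePreservingₗᵢ ℝ (fun x => x - latticePoint y)
    (measurePreserving_sub_right volume (latticePoint y))

theorem coeFn_lpShift {F : Type*} [NormedAddCommGroup F] [NormedSpace ℝ F] (y : Fin N → ℤ)
    (u : Lp F p (volume : Measure (EuclideanSpace ℝ (Fin N)))) :
    lpShift p F y u =ᵐ[volume] fun x => u (x - latticePoint y) :=
  Lp.coeFn_compMeasurePreserving u (measurePreserving_sub_right volume (latticePoint y))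

theorem norm_toLp_lpShift (y : Fin N → ℤ)
    (w : SobolevAmbient N p) :
    ‖(WithLp.toLp p (lpShift p ℝ y w.fst, lpShift p (EuclideanSpace ℝ (Fin N)) y w.snd) :
      SobolevAmbient N p)‖ = ‖w‖ := by
  rcases eq_or_ne p ∞ with rfl | h
  · simp [WithLp.prod_norm_eq_sup]
  · have h0 : 0 < p.toReal := ENNReal.toReal_pos (zero_lt_one.trans_le hp.out).ne' h
    simp [WithLp.prod_norm_eq_add h0]

/-- The shift `u ↦ u(· - y)` of `W^{1,p}(ℝ^N)` by the lattice vector `y`. It acts on the gradient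
in the same way. -/
noncomputable def sobolevShift (y : Fin N → ℤ) : SobolevW1 N p →ₗᵢ[ℝ] SobolevW1 N p where
  toFun u := ⟨WithLp.toLp p
      (lpShift p ℝ y (sobolevFun u), lpShift p (EuclideanSpace ℝ (Fin N)) y (sobolevGrad u)), by
    have h : IsWeakGradient N (sobolevFun u) (sobolevGrad u) := u.2
    have h' := isWeakGradient_shift h (latticePoint y)
    intro φ hφ hs i
    refine Eq.trans ?_ ((h' φ hφ hs i).trans ?_)
    · refine integral_congr_ae ?_
      filter_upwards [coeFn_lpShift p y (sobolevFun u)] with x hx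
      rw [← hx]
      rfl
    · refine congrArg Neg.neg (integral_congr_ae ?_)
      filter_upwards [coeFn_lpShift p y (sobolevGrad u)] with x hx
      rw [← hx]
      rfl⟩
  map_add' u v := by
    apply Subtype.ext
    apply (WithLp.equiv p _).injective
    exact Prod.ext (map_add (lpShift p ℝ y) _ _)
      (map_add (lpShift p (EuclideanSpace ℝ (Fin N)) y) _ _)
  map_smul' c u := by
    apply Subtype.ext
    apply (WithLp.equiv p _).injective
    exact Prod.ext (map_smul (lpShift p ℝ y) _ _)
      (map_smul (lpShift p (EuclideanSpace ℝ (Fin N)) y) _ _)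
  norm_map' u := norm_toLp_lpShift p y u.1

variable (N)

/-- The set `D = {u ↦ u(· - y) : y ∈ ℤ^N}` of the lattice shifts on `W^{1,p}(ℝ^N)`. -/
noncomputable def latticeShifts : Set (SobolevW1 N p →L[ℝ] SobolevW1 N p) :=
  Set.range fun y : Fin N → ℤ => (sobolevShift p y).toContinuousLinearMap

end SobolevSpace

set_option linter.unusedSectionVars false

section LpInequalities

variable {α β E F : Type*} [MeasurableSpace α] [MeasurableSpace β] [NormedAddCommGroup E]
  [NormedAddCommGroup F]

theorem lintegral_rpow_le_lintegral_rpow {ν : Measure β} [IsProbabilityMeasure ν] {r : ℝ}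
    (hr : 1 ≤ r) {f : β → ℝ≥0∞} (hf : AEMeasurable f ν) :
    (∫⁻ y, f y ∂ν) ^ r ≤ ∫⁻ y, f y ^ r ∂ν := by
  have h0 : 0 < r := zero_lt_one.trans_le hr
  have h := eLpNorm_le_eLpNorm_of_exponent_le (μ := ν) (f := f) (p := 1) (q := ENNReal.ofReal r)
    (by simpa using ENNReal.ofReal_le_ofReal hr) hf.aestronglyMeasurable
  rw [eLpNorm_one_eq_lintegral_enorm, eLpNorm_eq_lintegral_rpow_enorm_toReal (by simpa using h0)
    ENNReal.ofReal_ne_top, ENNReal.toReal_ofReal h0.le] at h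
  simp only [enorm_eq_self] at h
  calc (∫⁻ y, f y ∂ν) ^ r ≤ ((∫⁻ y, f y ^ r ∂ν) ^ (1 / r)) ^ r := by gcongr
    _ = ∫⁻ y, f y ^ r ∂ν := by
      rw [← ENNReal.rpow_mul, one_div_mul_cancel h0.ne', ENNReal.rpow_one]

/-- Minkowski's integral inequality for averages. -/
theorem eLpNorm_le_of_enorm_le_lintegral {μ : Measure α} [SFinite μ] {ν : Measure β}
    [IsProbabilityMeasure ν] {p : ℝ≥0} (hp : 1 ≤ p) {f : α → E} {G : α → β → F}
    (hG : AEStronglyMeasurable (Function.uncurry G) (μ.prod ν))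
    (hfG : ∀ᵐ x ∂μ, ‖f x‖ₑ ≤ ∫⁻ y, ‖G x y‖ₑ ∂ν) {C : ℝ≥0∞}
    (hC : ∀ᵐ y ∂ν, eLpNorm (fun x => G x y) p μ ≤ C) :
    eLpNorm f p μ ≤ C := by
  have h0 : 0 < p := zero_lt_one.trans_le hp
  have h0' : (0 : ℝ) < p := h0
  rw [← ENNReal.rpow_le_rpow_iff h0', eLpNorm_nnreal_pow_eq_lintegral h0.ne']
  calc ∫⁻ x, ‖f x‖ₑ ^ (p : ℝ) ∂μ ≤ ∫⁻ x, ∫⁻ y, ‖G x y‖ₑ ^ (p : ℝ) ∂ν ∂μ := by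
        refine lintegral_mono_ae ?_
        filter_upwards [hfG, hG.prodMk_left] with x hx hm
        refine (ENNReal.rpow_le_rpow hx h0'.le).trans ?_
        exact lintegral_rpow_le_lintegral_rpow (by exact_mod_cast hp) hm.enorm
    _ = ∫⁻ y, ∫⁻ x, ‖G x y‖ₑ ^ (p : ℝ) ∂μ ∂ν :=
        lintegral_lintegral_swap (hG.enorm.pow_const _)
    _ ≤ ∫⁻ _, C ^ (p : ℝ) ∂ν := by
        refine lintegral_mono_ae ?_
        filter_upwards [hC] with y hy
        rw [← eLpNorm_nnreal_pow_eq_lintegral h0.ne']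
        gcongr
    _ = C ^ (p : ℝ) := by simp

/-- Interpolation of the `L^q` norm between `L^p` and `L^r`. -/
theorem eLpNorm_le_eLpNorm_rpow_mul_eLpNorm_rpow {μ : Measure α} {p q r : ℝ≥0∞} {θ : ℝ}
    (h0 : 0 < θ) (h1 : θ < 1)
    (hq : q⁻¹ = ENNReal.ofReal (1 - θ) * p⁻¹ + ENNReal.ofReal θ * r⁻¹)
    {f : α → E} (hf : AEStronglyMeasurable f μ) :
    eLpNorm f q μ ≤ eLpNorm f p μ ^ (1 - θ) * eLpNorm f r μ ^ θ := by
  have h1' : 0 < 1 - θ := by linarith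
  have key : ∀ {s : ℝ≥0∞} {t : ℝ}, 0 < t → s / ENNReal.ofReal t * ENNReal.ofReal t = s :=
    fun {s t} ht => ENNReal.div_mul_cancel (by simpa using ht) ENNReal.ofReal_ne_top
  have hinv : ∀ {s : ℝ≥0∞} {t : ℝ}, 0 < t → (s / ENNReal.ofReal t)⁻¹ = ENNReal.ofReal t * s⁻¹ := by
    intro s t ht
    rw [ENNReal.inv_div (Or.inl ENNReal.ofReal_ne_top) (Or.inl (by simpa using ht)),
      div_eq_mul_inv]
  have : ENNReal.HolderTriple (p / ENNReal.ofReal (1 - θ)) (r / ENNReal.ofReal θ) q :=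
    ⟨by rw [hinv h1', hinv h0, hq]⟩
  have hm : ∀ t : ℝ, 0 < t → AEStronglyMeasurable (fun x => ‖f x‖ ^ t) μ := fun t ht =>
    (Real.continuous_rpow_const ht.le).comp_aestronglyMeasurable hf.norm
  have h := eLpNorm_le_eLpNorm_mul_eLpNorm'_of_norm (hm (1 - θ) h1') (hm θ h0)
    (fun a b : ℝ => a * b) 1 (Eventually.of_forall fun x => by simp)
    (p := p / ENNReal.ofReal (1 - θ)) (q := r / ENNReal.ofReal θ) (r := q)
  rw [eLpNorm_norm_rpow f h1', eLpNorm_norm_rpow f h0, key h1', key h0] at h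
  refine le_trans (le_of_eq ?_) (h.trans_eq (by simp))
  rw [← eLpNorm_norm f]
  congr 1
  ext x
  rw [← Real.rpow_add_of_nonneg (norm_nonneg _) h1'.le h0.le]
  simp

end LpInequalities

/-- A quantitative form of the uniform convexity of a norm, stated for its `p`-th power. -/
def UniformlyConvexPow (X : Type*) [NormedAddCommGroup X] [NormedSpace ℝ X] (p : ℝ) : Prop :=
  ∀ η : ℝ, 0 < η → ∃ C : ℝ, 0 ≤ C ∧ ∀ a b : X,
    ‖a - b‖ ^ p ≤ η * (‖a‖ ^ p + ‖b‖ ^ p) +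
      C * ((‖a‖ ^ p + ‖b‖ ^ p) / 2 - ‖(1 / 2 : ℝ) • (a + b)‖ ^ p)

section UniformConvexity

variable {X : Type*} [NormedAddCommGroup X] [NormedSpace ℝ X]

theorem norm_midpoint_le (a b : X) : ‖(1 / 2 : ℝ) • (a + b)‖ ≤ (‖a‖ + ‖b‖) / 2 := by
  rw [norm_smul]
  have := norm_add_le a b
  norm_num
  linarith

theorem rpow_midpoint_le {p : ℝ} (hp : 1 ≤ p) {x y : ℝ} (hx : 0 ≤ x) (hy : 0 ≤ y) :
    ((x + y) / 2) ^ p ≤ (x ^ p + y ^ p) / 2 := by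
  have h := (convexOn_rpow hp).2 (Set.mem_Ici.2 hx) (Set.mem_Ici.2 hy)
    (by norm_num : (0 : ℝ) ≤ 1 / 2) (by norm_num : (0 : ℝ) ≤ 1 / 2) (by norm_num)
  simp only [smul_eq_mul] at h
  rw [show (x + y) / 2 = 1 / 2 * x + 1 / 2 * y by ring]
  linarith

theorem norm_midpoint_rpow_le {p : ℝ} (hp : 1 ≤ p) (a b : X) :
    ‖(1 / 2 : ℝ) • (a + b)‖ ^ p ≤ (‖a‖ ^ p + ‖b‖ ^ p) / 2 :=
  (Real.rpow_le_rpow (norm_nonneg _) (norm_midpoint_le a b) (by linarith)).trans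
    (rpow_midpoint_le hp (norm_nonneg _) (norm_nonneg _))

theorem eq_of_norm_midpoint_rpow_eq [StrictConvexSpace ℝ X] {p : ℝ} (hp : 1 < p) {a b : X}
    (h : (‖a‖ ^ p + ‖b‖ ^ p) / 2 ≤ ‖(1 / 2 : ℝ) • (a + b)‖ ^ p) : a = b := by
  have h1 : ‖(1 / 2 : ℝ) • (a + b)‖ ^ p ≤ ((‖a‖ + ‖b‖) / 2) ^ p :=
    Real.rpow_le_rpow (norm_nonneg _) (norm_midpoint_le a b) (by linarith)
  have hab : ‖a‖ = ‖b‖ := by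
    by_contra hne
    have h2 := (strictConvexOn_rpow hp).2 (Set.mem_Ici.2 (norm_nonneg a))
      (Set.mem_Ici.2 (norm_nonneg b)) hne
      (by norm_num : (0 : ℝ) < 1 / 2) (by norm_num : (0 : ℝ) < 1 / 2) (by norm_num)
    simp only [smul_eq_mul] at h2
    have e : 1 / 2 * ‖a‖ + 1 / 2 * ‖b‖ = (‖a‖ + ‖b‖) / 2 := by ring
    rw [e] at h2
    linarith
  rw [← hab] at h
  have h3 : ‖a‖ ≤ ‖(1 / 2 : ℝ) • (a + b)‖ :=
    (Real.rpow_le_rpow_iff (norm_nonneg _) (norm_nonneg _) (by linarith : (0 : ℝ) < p)).1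
      (by linarith)
  rw [norm_smul] at h3
  norm_num at h3
  refine eq_of_norm_eq_of_norm_add_eq hab (le_antisymm (norm_add_le a b) ?_)
  linarith

theorem uniformlyConvexPow_of_finiteDimensional [FiniteDimensional ℝ X] [StrictConvexSpace ℝ X]
    {p : ℝ} (hp : 1 < p) : UniformlyConvexPow X p := by
  intro η hη
  have hp0 : 0 < p := by linarith
  have : ProperSpace X := FiniteDimensional.proper_real X
  let D : X × X → ℝ := fun z => ‖z.1 - z.2‖ ^ p - η * (‖z.1‖ ^ p + ‖z.2‖ ^ p)
  let B : X × X → ℝ := fun z => (‖z.1‖ ^ p + ‖z.2‖ ^ p) / 2 - ‖(1 / 2 : ℝ) • (z.1 + z.2)‖ ^ p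
  have cp : Continuous fun x : ℝ => x ^ p := Real.continuous_rpow_const hp0.le
  have hD : Continuous D := by
    exact (cp.comp (by fun_prop)).sub (continuous_const.mul
      ((cp.comp (by fun_prop)).add (cp.comp (by fun_prop))))
  have hB : Continuous B := by
    exact (((cp.comp (by fun_prop)).add (cp.comp (by fun_prop))).div_const _).sub
      (cp.comp (by fun_prop))
  have hB0 : ∀ z, 0 ≤ B z := fun z => by
    have := norm_midpoint_rpow_le hp.le z.1 z.2
    simp only [B]; linarith
  have hK : IsCompact (Metric.sphere (0 : X × X) 1 ∩ {z | 0 ≤ D z}) :=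
    (isCompact_sphere _ _).inter_right (isClosed_le continuous_const hD)
  have hBpos : ∀ z ∈ Metric.sphere (0 : X × X) 1 ∩ {z | 0 ≤ D z}, 0 < B z := by
    rintro ⟨a, b⟩ ⟨hz, hDz⟩
    refine lt_of_le_of_ne (hB0 _) fun h => ?_
    obtain rfl : a = b := eq_of_norm_midpoint_rpow_eq hp (by simp only [B] at h; linarith)
    have ha : ‖a‖ = 1 := by simpa [Prod.norm_def] using hz
    simp only [D, Set.mem_ofPred_eq, sub_self, norm_zero, Real.zero_rpow hp0.ne', ha,
      Real.one_rpow] at hDz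
    linarith
  obtain ⟨C, hC0, hC⟩ : ∃ C : ℝ, 0 ≤ C ∧ ∀ z ∈ Metric.sphere (0 : X × X) 1, D z ≤ C * B z := by
    rcases (Metric.sphere (0 : X × X) 1 ∩ {z | 0 ≤ D z}).eq_empty_or_nonempty with he | hne
    · refine ⟨0, le_rfl, fun z hz => ?_⟩
      by_contra! hlt
      exact Set.notMem_empty z (he ▸ ⟨hz, by simpa using hlt.le⟩)
    · obtain ⟨z₀, hz₀, hmin⟩ := hK.exists_isMinOn hne hB.continuousOn
      obtain ⟨z₁, hz₁, hmax⟩ := hK.exists_isMaxOn hne hD.continuousOn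
      have hm := hBpos z₀ hz₀
      have hD1 : 0 ≤ D z₁ := hz₁.2
      refine ⟨D z₁ / B z₀, by positivity, fun z hz => ?_⟩
      by_cases h : 0 ≤ D z
      · have e1 : D z ≤ D z₁ := hmax ⟨hz, h⟩
        have e2 : B z₀ ≤ B z := hmin ⟨hz, h⟩
        calc D z ≤ D z₁ / B z₀ * B z₀ := by rwa [div_mul_cancel₀ _ hm.ne']
          _ ≤ D z₁ / B z₀ * B z := by gcongr
      · have := hB0 z
        exact (not_le.1 h).le.trans (by positivity)
  refine ⟨C, hC0, fun a b => ?_⟩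
  suffices h : D (a, b) ≤ C * B (a, b) by simp only [D, B] at h; linarith
  rcases eq_or_ne ((a, b) : X × X) 0 with h0 | h0
  · rw [h0]
    simp [D, B, Real.zero_rpow hp0.ne']
  · have ht : 0 < ‖((a, b) : X × X)‖ := norm_pos_iff.2 h0
    set t := ‖((a, b) : X × X)‖ with ht'
    have hs : ∀ c : X, ‖c‖ ^ p = t ^ p * ‖t⁻¹ • c‖ ^ p := fun c => by
      rw [norm_smul, Real.mul_rpow (norm_nonneg _) (norm_nonneg _), ← mul_assoc,
        ← Real.mul_rpow ht.le (norm_nonneg _), Real.norm_of_nonneg (by positivity),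
        mul_inv_cancel₀ ht.ne', Real.one_rpow, one_mul]
    have hz := hC (t⁻¹ • (a, b)) (by
      rw [mem_sphere_zero_iff_norm, norm_smul, ← ht', Real.norm_of_nonneg (by positivity),
        inv_mul_cancel₀ ht.ne'])
    have eD : D (a, b) = t ^ p * D (t⁻¹ • (a, b)) := by
      simp only [D, Prod.smul_mk, hs a, hs b, hs (a - b), smul_sub]; ring
    have eB : B (a, b) = t ^ p * B (t⁻¹ • (a, b)) := by
      simp only [B, Prod.smul_mk]
      rw [hs a, hs b, hs ((1 / 2 : ℝ) • (a + b)), smul_comm t⁻¹ (1 / 2 : ℝ), smul_add]; ring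
    rw [eD, eB]
    have : 0 ≤ t ^ p := by positivity
    nlinarith

theorem UniformlyConvexPow.submodule {p : ℝ} (h : UniformlyConvexPow X p) (S : Submodule ℝ X) :
    UniformlyConvexPow S p := by
  intro η hη
  obtain ⟨C, hC0, hC⟩ := h η hη
  exact ⟨C, hC0, fun a b => hC a b⟩

theorem UniformlyConvexPow.withLp_prod {Y : Type*} [NormedAddCommGroup Y] [NormedSpace ℝ Y]
    {p : ℝ≥0} [Fact (1 ≤ (p : ℝ≥0∞))] (hX : UniformlyConvexPow X p)
    (hY : UniformlyConvexPow Y p) : UniformlyConvexPow (WithLp (p : ℝ≥0∞) (X × Y)) p := by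
  intro η hη
  have hp1 : (1 : ℝ) ≤ p := by
    have := Fact.out (p := (1 ≤ (p : ℝ≥0∞)))
    exact_mod_cast this
  have hp0 : (0 : ℝ) < p := by linarith
  have hn : ∀ w : WithLp (p : ℝ≥0∞) (X × Y), ‖w‖ ^ (p : ℝ) = ‖w.fst‖ ^ (p : ℝ) + ‖w.snd‖ ^ (p : ℝ) := by
    intro w
    rw [WithLp.prod_norm_eq_add (by simpa using hp0), ENNReal.coe_toReal, ← Real.rpow_mul
      (by positivity), one_div_mul_cancel hp0.ne', Real.rpow_one]
  obtain ⟨C, hC0, hC⟩ := hX η hη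
  obtain ⟨C', hC0', hC'⟩ := hY η hη
  refine ⟨max C C', le_max_of_le_left hC0, fun a b => ?_⟩
  have h1 := hC a.fst b.fst
  have h2 := hC' a.snd b.snd
  have b1 := norm_midpoint_rpow_le hp1 a.fst b.fst
  have b2 := norm_midpoint_rpow_le hp1 a.snd b.snd
  have m1 := mul_le_mul_of_nonneg_right (le_max_left C C') (sub_nonneg.2 b1)
  have m2 := mul_le_mul_of_nonneg_right (le_max_right C C') (sub_nonneg.2 b2)
  rw [hn, hn, hn, hn]
  simp only [WithLp.sub_fst, WithLp.sub_snd, WithLp.smul_fst, WithLp.smul_snd, WithLp.add_fst,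
    WithLp.add_snd]
  nlinarith

theorem uniformlyConvexPow_Lp {α : Type*} [MeasurableSpace α] {μ : Measure α} {p : ℝ≥0}
    [Fact (1 ≤ (p : ℝ≥0∞))] (h : UniformlyConvexPow X p) :
    UniformlyConvexPow (Lp X p μ) p := by
  intro η hη
  have hp1 : (1 : ℝ≥0) ≤ p := by
    have := Fact.out (p := (1 ≤ (p : ℝ≥0∞)))
    exact_mod_cast this
  have hp0 : p ≠ 0 := (zero_lt_one.trans_le hp1).ne'
  have hn : ∀ u : Lp X p μ, ‖u‖ ^ (p : ℝ) = ∫ x, ‖u x‖ ^ (p : ℝ) ∂μ := by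
    intro u
    rw [Lp.norm_def, ENNReal.toReal_rpow, eLpNorm_nnreal_pow_eq_lintegral hp0,
      integral_eq_lintegral_of_nonneg_ae (Eventually.of_forall fun x => by positivity)
        ((Real.continuous_rpow_const (by positivity)).comp_aestronglyMeasurable
          (Lp.aestronglyMeasurable u).norm)]
    congr 1
    refine lintegral_congr fun x => ?_
    rw [← ENNReal.ofReal_rpow_of_nonneg (norm_nonneg _) (by positivity), ofReal_norm]
  have hi : ∀ u : Lp X p μ, Integrable (fun x => ‖u x‖ ^ (p : ℝ)) μ := fun u => by
    simpa using (Lp.memLp u).integrable_norm_rpow (by simpa using hp0) ENNReal.coe_ne_top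
  obtain ⟨C, hC0, hC⟩ := h η hη
  refine ⟨C, hC0, fun a b => ?_⟩
  have i1 : Integrable (fun x => ‖a x‖ ^ (p : ℝ) + ‖b x‖ ^ (p : ℝ)) μ := (hi a).add (hi b)
  have i2 : Integrable (fun x => (‖a x‖ ^ (p : ℝ) + ‖b x‖ ^ (p : ℝ)) / 2 -
      ‖((1 / 2 : ℝ) • (a + b)) x‖ ^ (p : ℝ)) μ := (i1.div_const 2).sub (hi _)
  rw [hn, hn, hn, hn, ← integral_add (hi a) (hi b), ← integral_div,
    ← integral_sub (i1.div_const 2) (hi _), ← integral_const_mul, ← integral_const_mul,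
    ← integral_add (i1.const_mul η) (i2.const_mul C)]
  refine integral_mono_ae (hi _) ((i1.const_mul η).add (i2.const_mul C)) ?_
  filter_upwards [Lp.coeFn_sub a b, Lp.coeFn_smul (1 / 2 : ℝ) (a + b), Lp.coeFn_add a b]
    with x h1 h2 h3
  rw [h1, h2, Pi.smul_apply, h3]
  exact hC (a x) (b x)

/-- Every bounded sequence in a uniformly convex Banach space has norm convergent convex
combinations of its tails. -/
theorem UniformlyConvexPow.exists_tendsto_convexHull [CompleteSpace X] {p : ℝ} (hp : 1 ≤ p)
    (h : UniformlyConvexPow X p) {v : ℕ → X} (hv : Bornology.IsBounded (Set.range v)) :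
    ∃ (w : X) (c : ℕ → X), (∀ n, c n ∈ convexHull ℝ (v '' Set.Ici n)) ∧
      Tendsto c atTop (𝓝 w) := by
  have hp0 : 0 < p := by linarith
  obtain ⟨M, hM⟩ := hv.exists_norm_le
  have hM0 : 0 ≤ M := (norm_nonneg _).trans (hM (v 0) ⟨0, rfl⟩)
  let K : ℕ → Set X := fun n => convexHull ℝ (v '' Set.Ici n)
  have hKanti : ∀ {n k}, n ≤ k → K k ⊆ K n := fun hnk =>
    convexHull_mono (Set.image_mono (Set.Ici_subset_Ici.2 hnk))
  have hKM : ∀ n, ∀ x ∈ K n, ‖x‖ ≤ M := fun n x hx => by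
    have : K n ⊆ Metric.closedBall 0 M := convexHull_min (by
      rintro _ ⟨k, -, rfl⟩
      simpa using hM (v k) ⟨k, rfl⟩) (convex_closedBall _ _)
    simpa using this hx
  have hKv : ∀ n, v n ∈ K n := fun n => subset_convexHull _ _ ⟨n, Set.self_mem_Ici, rfl⟩
  let S : ℕ → Set ℝ := fun n => (fun x => ‖x‖ ^ p) '' K n
  have hSb : ∀ n, BddBelow (S n) := fun n => ⟨0, by rintro _ ⟨x, -, rfl⟩; positivity⟩
  have hSne : ∀ n, (S n).Nonempty := fun n => ⟨_, v n, hKv n, rfl⟩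
  let m : ℕ → ℝ := fun n => sInf (S n)
  have hm_le : ∀ n, ∀ x ∈ K n, m n ≤ ‖x‖ ^ p := fun n x hx => csInf_le (hSb n) ⟨x, hx, rfl⟩
  have hmM : ∀ n, m n ≤ M ^ p := fun n => (hm_le n _ (hKv n)).trans
    (Real.rpow_le_rpow (norm_nonneg _) (hKM n _ (hKv n)) hp0.le)
  have hmono : Monotone m := fun n k hnk =>
    csInf_le_csInf (hSb n) (hSne k) (Set.image_mono (hKanti hnk))
  have hmlim : Tendsto m atTop (𝓝 (⨆ n, m n)) :=
    tendsto_atTop_ciSup hmono ⟨M ^ p, by rintro _ ⟨n, rfl⟩; exact hmM n⟩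
  have hmsup : ∀ n, m n ≤ ⨆ n, m n := fun n =>
    le_ciSup ⟨M ^ p, by rintro _ ⟨n, rfl⟩; exact hmM n⟩ n
  set s := ⨆ n, m n
  have hex : ∀ n : ℕ, ∃ x ∈ K n, ‖x‖ ^ p < m n + 1 / ((n : ℝ) + 1) := fun n => by
    obtain ⟨_, ⟨x, hx, rfl⟩, hlt⟩ := exists_lt_of_csInf_lt (hSne n)
      (show sInf (S n) < m n + 1 / ((n : ℝ) + 1) from lt_add_of_pos_right _ (by positivity))
    exact ⟨x, hx, hlt⟩
  choose c hcK hc using hex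
  have hcauchy : CauchySeq c := by
    refine Metric.cauchySeq_iff'.2 fun ε hε => ?_
    set δ := ε ^ p with hδ'
    have hδ : 0 < δ := by positivity
    obtain ⟨C, hC0, hC⟩ := h (δ / (4 * (M ^ p + 1))) (by positivity)
    have hlim : Tendsto (fun n : ℕ => C * ((s - m n) / 2 + 1 / ((n : ℝ) + 1))) atTop (𝓝 0) := by
      have h1 : Tendsto (fun n : ℕ => (s - m n) / 2 + 1 / ((n : ℝ) + 1)) atTop (𝓝 0) := by
        simpa using (((tendsto_const_nhds (x := s)).sub hmlim).div_const 2).add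
          (tendsto_one_div_add_atTop_nhds_zero_nat (𝕜 := ℝ))
      simpa using h1.const_mul C
    obtain ⟨n, hn⟩ := (hlim.eventually_lt_const (half_pos hδ)).exists
    refine ⟨n, fun k hk => ?_⟩
    have hmid : (1 / 2 : ℝ) • (c k + c n) ∈ K n := by
      rw [smul_add]
      exact convex_convexHull ℝ _ (hKanti hk (hcK k)) (hcK n) (by norm_num) (by norm_num)
        (by norm_num)
    have e1 := hC (c k) (c n)
    have e2 := hm_le n _ hmid
    have e3 := hc k
    have e4 := hc n
    have e5 := hmsup k
    have e6 : 1 / ((k : ℝ) + 1) ≤ 1 / ((n : ℝ) + 1) := by gcongr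
    have e7 : ∀ j, ‖c j‖ ^ p ≤ M ^ p := fun j =>
      Real.rpow_le_rpow (norm_nonneg _) (hKM j _ (hcK j)) hp0.le
    have e8 : δ / (4 * (M ^ p + 1)) * (‖c k‖ ^ p + ‖c n‖ ^ p) ≤ δ / 2 := by
      have hMp : 0 ≤ M ^ p := by positivity
      calc _ ≤ δ / (4 * (M ^ p + 1)) * (2 * (M ^ p + 1)) := by
            gcongr
            linarith [e7 k, e7 n]
        _ = δ / 2 := by field_simp; norm_num
    have e9 : C * ((‖c k‖ ^ p + ‖c n‖ ^ p) / 2 - ‖(1 / 2 : ℝ) • (c k + c n)‖ ^ p) ≤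
        C * ((s - m n) / 2 + 1 / ((n : ℝ) + 1)) := by
      gcongr
      linarith
    have e10 : ‖c k - c n‖ ^ p < ε ^ p := by linarith
    rw [dist_eq_norm]
    exact (Real.rpow_lt_rpow_iff (norm_nonneg _) hε.le hp0).1 e10
  obtain ⟨w, hw⟩ := cauchySeq_tendsto_of_complete hcauchy
  exact ⟨w, c, hcK, hw⟩

theorem UniformlyConvexPow.tendsto_apply_of_injective [CompleteSpace X] {p : ℝ} (hp : 1 ≤ p)
    (h : UniformlyConvexPow X p) {Y : Type*} [NormedAddCommGroup Y] [NormedSpace ℝ Y]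
    {ι : X →L[ℝ] Y} (hι : Function.Injective ι) {v : ℕ → X}
    (hv : Bornology.IsBounded (Set.range v)) (hv0 : Tendsto (fun k => ‖ι (v k)‖) atTop (𝓝 0))
    (f : X →L[ℝ] ℝ) : Tendsto (fun k => f (v k)) atTop (𝓝 0) := by
  have key : ∀ f : X →L[ℝ] ℝ, ∀ ε > 0, ¬ ∃ᶠ k in atTop, ε ≤ f (v k) := by
    intro f ε hε hfr
    obtain ⟨φ, hφ, hφ'⟩ := extraction_of_frequently_atTop hfr
    obtain ⟨w, c, hc, hw⟩ := h.exists_tendsto_convexHull hp (v := v ∘ φ)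
      (hv.subset (Set.range_comp_subset_range _ _))
    have hιw : ι w = 0 := by
      have h1 : Tendsto (fun n => ι (c n)) atTop (𝓝 (ι w)) := (ι.continuous.tendsto w).comp hw
      refine tendsto_nhds_unique h1 ?_
      rw [Metric.tendsto_atTop] at hv0 ⊢
      intro r hr
      obtain ⟨n₀, hn₀⟩ := hv0 (r / 2) (by positivity)
      refine ⟨n₀, fun n hn => ?_⟩
      have hsub : convexHull ℝ ((v ∘ φ) '' Set.Ici n) ⊆ ι ⁻¹' Metric.closedBall 0 (r / 2) := by
        refine convexHull_min ?_ ((convex_closedBall _ _).linear_preimage ι.toLinearMap)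
        rintro _ ⟨k, hk, rfl⟩
        have := hn₀ (φ k) (hn.trans (le_trans hk (hφ.id_le k)))
        simp only [dist_zero_right, norm_norm] at this
        simpa using this.le
      have := hsub (hc n)
      simp only [Set.mem_preimage, mem_closedBall_zero_iff] at this
      rw [dist_zero_right]
      linarith
    have hw0 : w = 0 := hι (by rw [hιw, map_zero])
    have h2 : Tendsto (fun n => f (c n)) atTop (𝓝 (f w)) := (f.continuous.tendsto w).comp hw
    have h3 : ε ≤ f w := ge_of_tendsto' h2 fun n => by
      have hsub : convexHull ℝ ((v ∘ φ) '' Set.Ici n) ⊆ f ⁻¹' Set.Ici ε := by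
        refine convexHull_min ?_ ((convex_Ici ε).linear_preimage f.toLinearMap)
        rintro _ ⟨k, -, rfl⟩
        exact hφ' k
      exact hsub (hc n)
    rw [hw0, map_zero] at h3
    linarith
  rw [Metric.tendsto_nhds]
  intro ε hε
  have h1 := key f ε hε
  have h2 := key (-f) ε hε
  rw [not_frequently] at h1 h2
  filter_upwards [h1, h2] with k hk1 hk2
  simp only [not_le, neg_apply] at hk1 hk2
  rw [dist_zero_right, Real.norm_eq_abs, abs_lt]
  constructor <;> linarith

end UniformConvexity

section Mollification

open scoped Convolution
open ContinuousLinearMap (lsmul)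

variable {E F : Type*} [NormedAddCommGroup E] [NormedSpace ℝ E] [FiniteDimensional ℝ E]
  [MeasurableSpace E] [BorelSpace E] {μ : Measure E} [μ.IsAddHaarMeasure]
  [NormedAddCommGroup F] [NormedSpace ℝ F]

/-- The convolution of `u` with the normalized bump function `ρ`. -/
noncomputable def ContDiffBump.mollify (ρ : ContDiffBump (0 : E)) (μ : Measure E) (u : E → F) :
    E → F :=
  ρ.normed μ ⋆[lsmul ℝ ℝ, μ] u

/-- The probability measure whose density is the normalized bump function `ρ`. -/
noncomputable def ContDiffBump.toMeasure (ρ : ContDiffBump (0 : E)) (μ : Measure E) : Measure E :=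
  μ.withDensity fun x => ENNReal.ofReal (ρ.normed μ x)

namespace ContDiffBump

variable (ρ : ContDiffBump (0 : E))

instance : IsProbabilityMeasure (ρ.toMeasure μ) where
  measure_univ := by
    rw [toMeasure, withDensity_apply _ MeasurableSet.univ, Measure.restrict_univ,
      ← ofReal_integral_eq_lintegral_ofReal ρ.integrable_normed
        (Eventually.of_forall ρ.nonneg_normed), ρ.integral_normed, ENNReal.ofReal_one]

theorem toMeasure_absolutelyContinuous : ρ.toMeasure μ ≪ μ :=
  withDensity_absolutelyContinuous _ _

theorem lintegral_toMeasure {f : E → ℝ≥0∞} (hf : AEMeasurable f μ) :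
    ∫⁻ y, f y ∂(ρ.toMeasure μ) = ∫⁻ y, ENNReal.ofReal (ρ.normed μ y) * f y ∂μ := by
  rw [toMeasure, lintegral_withDensity_eq_lintegral_mul₀
    ρ.continuous_normed.measurable.ennreal_ofReal.aemeasurable hf]
  rfl

theorem ae_toMeasure_norm_le : ∀ᵐ y ∂(ρ.toMeasure μ), ‖y‖ ≤ ρ.rOut := by
  rw [toMeasure, ae_withDensity_iff ρ.continuous_normed.measurable.ennreal_ofReal]
  refine Eventually.of_forall fun y hy => ?_
  have : y ∈ Function.support (ρ.normed μ) := fun h => hy (by rw [h, ENNReal.ofReal_zero])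
  rw [ρ.support_normed_eq, mem_ball_zero_iff] at this
  exact this.le

theorem enorm_integral_normed_smul_le {w : E → F} (hw : AEStronglyMeasurable w μ) :
    ‖∫ y, ρ.normed μ y • w y ∂μ‖ₑ ≤ ∫⁻ y, ‖w y‖ₑ ∂(ρ.toMeasure μ) := by
  rw [lintegral_toMeasure ρ hw.enorm]
  refine (enorm_integral_le_lintegral_enorm _).trans_eq (lintegral_congr fun y => ?_)
  rw [enorm_smul, Real.enorm_of_nonneg (ρ.nonneg_normed y)]

theorem aestronglyMeasurable_comp_sub {u : E → F} (hu : AEStronglyMeasurable u μ) :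
    AEStronglyMeasurable (Function.uncurry fun x y => u (x - y)) (μ.prod (ρ.toMeasure μ)) :=
  hu.comp_quasiMeasurePreserving
    ((quasiMeasurePreserving_sub_of_right_invariant μ μ).mono_left
      (Measure.AbsolutelyContinuous.rfl.prod ρ.toMeasure_absolutelyContinuous))

theorem aestronglyMeasurable_comp_const_sub {u : E → F} (hu : AEStronglyMeasurable u μ) (x : E) :
    AEStronglyMeasurable (fun y => u (x - y)) μ :=
  hu.comp_quasiMeasurePreserving (quasiMeasurePreserving_sub_left_of_right_invariant μ x)

theorem eLpNorm_comp_sub_right {u : E → F} (hu : AEStronglyMeasurable u μ) (p : ℝ≥0∞) (y : E) :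
    eLpNorm (fun x => u (x - y)) p μ = eLpNorm u p μ :=
  eLpNorm_comp_measurePreserving hu (measurePreserving_sub_right μ y)

theorem eLpNorm_mollify_le {p : ℝ≥0} (hp : 1 ≤ p) {u : E → F} (hu : AEStronglyMeasurable u μ) :
    eLpNorm (ρ.mollify μ u) p μ ≤ eLpNorm u p μ := by
  refine eLpNorm_le_of_enorm_le_lintegral hp (ν := ρ.toMeasure μ)
    (ρ.aestronglyMeasurable_comp_sub hu) (Eventually.of_forall fun x => ?_)
    (Eventually.of_forall fun y => (eLpNorm_comp_sub_right hu p y).le)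
  exact ρ.enorm_integral_normed_smul_le (aestronglyMeasurable_comp_const_sub hu x)

theorem integrable_normed_smul_comp_sub {u : E → F} (hu : LocallyIntegrable u μ) (x : E) :
    Integrable (fun y => ρ.normed μ y • u (x - y)) μ :=
  (ρ.hasCompactSupport_normed.convolutionExists_left (lsmul ℝ ℝ) ρ.continuous_normed hu x).integrable

theorem contDiff_mollify {u : E → F} (hu : LocallyIntegrable u μ) :
    ContDiff ℝ ∞ (ρ.mollify μ u) :=
  ρ.hasCompactSupport_normed.contDiff_convolution_left _ ρ.contDiff_normed hu

theorem mollify_eq_swap (u : E → F) (x : E) :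
    ρ.mollify μ u x = ∫ y, ρ.normed μ (x - y) • u y ∂μ := by
  rw [mollify, convolution_eq_swap]
  rfl

/-- If all the translates of `u` by small vectors are close to `u` in `L^p`, so is the
mollification. -/
theorem eLpNorm_mollify_sub_le [CompleteSpace F] {p : ℝ≥0} (hp : 1 ≤ p) {u : E → F}
    (hu : LocallyIntegrable u μ) {C : ℝ≥0∞}
    (hC : ∀ y, ‖y‖ ≤ ρ.rOut → eLpNorm (fun x => u (x - y) - u x) p μ ≤ C) :
    eLpNorm (fun x => ρ.mollify μ u x - u x) p μ ≤ C := by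
  have hm := hu.aestronglyMeasurable
  refine eLpNorm_le_of_enorm_le_lintegral hp (ν := ρ.toMeasure μ)
    (G := fun x y => u (x - y) - u x) ?_ (Eventually.of_forall fun x => ?_) ?_
  · exact (ρ.aestronglyMeasurable_comp_sub hm).sub (hm.comp_fst)
  · have : ρ.mollify μ u x - u x = ∫ y, ρ.normed μ y • (u (x - y) - u x) ∂μ := by
      simp only [smul_sub]
      rw [integral_sub (ρ.integrable_normed_smul_comp_sub hu x) (ρ.integrable_normed.smul_const _),
        ρ.integral_normed_smul]
      rfl
    rw [this]
    exact ρ.enorm_integral_normed_smul_le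
      ((aestronglyMeasurable_comp_const_sub hm x).sub aestronglyMeasurable_const)
  · filter_upwards [ρ.ae_toMeasure_norm_le] with y hy using hC y hy

variable (E) in
/-- A sequence of bump functions at the origin whose supports shrink to the origin. -/
noncomputable def shrinking (n : ℕ) : ContDiffBump (0 : E) :=
  ⟨1 / ((n : ℝ) + 1), 2 / ((n : ℝ) + 1), by positivity, by gcongr; norm_num⟩

variable (E) in
theorem tendsto_rOut_shrinking : Tendsto (fun n => (shrinking E n).rOut) atTop (𝓝 0) := by
  have h := (tendsto_one_div_add_atTop_nhds_zero_nat (𝕜 := ℝ)).const_mul 2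
  simpa [shrinking, div_eq_mul_inv] using h

theorem ae_tendsto_mollify_shrinking [CompleteSpace F] {u : E → F} (hu : LocallyIntegrable u μ) :
    ∀ᵐ x ∂μ, Tendsto (fun n => (shrinking E n).mollify μ u x) atTop (𝓝 (u x)) := by
  refine ae_convolution_tendsto_right_of_locallyIntegrable (K := 2) (tendsto_rOut_shrinking E)
    (Eventually.of_forall fun n => ?_) hu
  simp only [shrinking]
  exact le_of_eq (by ring)

end ContDiffBump

theorem eLpNorm_comp_sub_sub_le {p : ℝ≥0} (hp : 1 ≤ p) [CompleteSpace F] {v : E → F}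
    (hv : ContDiff ℝ 1 v) (h : E) :
    eLpNorm (fun x => v (x - h) - v x) p μ ≤ ‖h‖ₑ * eLpNorm (fderiv ℝ v) p μ := by
  have hc : Continuous (fderiv ℝ v) := hv.continuous_fderiv one_ne_zero
  have : IsProbabilityMeasure ((volume : Measure ℝ).restrict (Set.Icc 0 1)) := ⟨by simp⟩
  refine eLpNorm_le_of_enorm_le_lintegral hp (ν := (volume : Measure ℝ).restrict (Set.Icc 0 1))
    (G := fun x t => ‖h‖ • fderiv ℝ v (x - t • h)) ?_ (Eventually.of_forall fun x => ?_)
    (Eventually.of_forall fun t => ?_)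
  · refine Continuous.aestronglyMeasurable ?_
    exact (hc.comp (by fun_prop : Continuous fun z : E × ℝ => z.1 - z.2 • h)).const_smul ‖h‖
  · have hd : ∀ t : ℝ, HasDerivAt (fun t : ℝ => v (x - t • h)) (fderiv ℝ v (x - t • h) (-h)) t := by
      intro t
      have h1 : HasDerivAt (fun t : ℝ => x - t • h) (-h) t := by
        simpa using ((hasDerivAt_id t).smul_const h).const_sub x
      exact ((hv.differentiable one_ne_zero _).hasFDerivAt).comp_hasDerivAt t h1
    have h1 := enorm_sub_le_lintegral_deriv_of_contDiffOn_Icc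
      (f := fun t : ℝ => v (x - t • h)) (a := 0) (b := 1)
      (hv.comp (by fun_prop)).contDiffOn zero_le_one
    simp only [one_smul, zero_smul, sub_zero] at h1
    refine h1.trans ?_
    refine lintegral_mono fun t => ?_
    rw [(hd t).deriv, enorm_smul, enorm_norm, mul_comm]
    refine (ContinuousLinearMap.le_opENorm _ _).trans_eq ?_
    rw [enorm_neg]
  · refine (eLpNorm_const_smul_le (c := ‖h‖) (f := fun x => fderiv ℝ v (x - t • h))).trans_eq ?_
    rw [enorm_norm, ContDiffBump.eLpNorm_comp_sub_right hc.aestronglyMeasurable]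

/-- The Gagliardo–Nirenberg–Sobolev inequality for functions that need not have compact support. -/
theorem exists_eLpNorm_le_eLpNorm_fderiv (μ : Measure E) [μ.IsAddHaarMeasure] {p r : ℝ≥0}
    (hp : 1 ≤ p) (hE : 0 < Module.finrank ℝ E)
    (hr : (r : ℝ)⁻¹ = (p : ℝ)⁻¹ - (Module.finrank ℝ E : ℝ)⁻¹) :
    ∃ C : ℝ≥0, ∀ v : E → ℝ, ContDiff ℝ 1 v → MemLp v p μ →
      eLpNorm v r μ ≤ C * eLpNorm (fderiv ℝ v) p μ := by
  obtain ⟨C, hC⟩ : ∃ C : ℝ≥0, ∀ v : E → ℝ, ContDiff ℝ 1 v → HasCompactSupport v →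
      eLpNorm v r μ ≤ C * eLpNorm (fderiv ℝ v) p μ :=
    ⟨_, fun v hv hs => eLpNorm_le_eLpNorm_fderiv_of_eq μ hv hs hp hE hr⟩
  refine ⟨C, fun v hv hvp => ?_⟩
  let χ : ContDiffBump (0 : E) := ⟨1, 2, one_pos, one_lt_two⟩
  have hχ : ContDiff ℝ 1 χ := χ.contDiff
  obtain ⟨K, hK⟩ : ∃ K : ℝ≥0, ∀ x, ‖fderiv ℝ χ x‖ ≤ K := by
    obtain ⟨K, hK⟩ := (hχ.continuous_fderiv one_ne_zero).bounded_above_of_compact_support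
      (χ.hasCompactSupport.fderiv ℝ)
    exact ⟨K.toNNReal, fun x => (hK x).trans (Real.le_coe_toNNReal K)⟩
  let c : ℕ → ℝ := fun n => 1 / ((n : ℝ) + 1)
  have hc0 : ∀ n, 0 < c n := fun n => by positivity
  have hclim : Tendsto c atTop (𝓝 0) := tendsto_one_div_add_atTop_nhds_zero_nat
  let w : ℕ → E → ℝ := fun n x => χ (c n • x) * v x
  have hχc : ∀ n, ContDiff ℝ 1 fun x => χ (c n • x) := fun n => hχ.comp (by fun_prop)
  have hw : ∀ n, ContDiff ℝ 1 (w n) := fun n => (hχc n).mul hv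
  have hws : ∀ n, HasCompactSupport (w n) := fun n =>
    HasCompactSupport.mul_right (χ.hasCompactSupport.comp_homeomorph
      (Homeomorph.smulOfNeZero (c n) (hc0 n).ne'))
  have hfd : ∀ n x, ‖fderiv ℝ (w n) x‖ ≤ ‖fderiv ℝ v x‖ + ‖(c n * K) • v x‖ := by
    intro n x
    have h1 : HasFDerivAt (fun x => χ (c n • x))
        ((fderiv ℝ χ (c n • x)).comp (c n • ContinuousLinearMap.id ℝ E)) x :=
      ((hχ.differentiable one_ne_zero _).hasFDerivAt).comp x
        ((ContinuousLinearMap.id ℝ E).hasFDerivAt.const_smul (c n))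
    have h2 : HasFDerivAt (w n) _ x := h1.mul ((hv.differentiable one_ne_zero x).hasFDerivAt)
    rw [h2.fderiv]
    refine (norm_add_le _ _).trans (add_le_add ?_ ?_)
    · rw [norm_smul, Real.norm_of_nonneg χ.nonneg]
      exact mul_le_of_le_one_left (norm_nonneg _) χ.le_one
    · rw [norm_smul, norm_smul, ContinuousLinearMap.comp_smul, norm_smul,
        ContinuousLinearMap.comp_id, norm_mul, mul_comm, Real.norm_of_nonneg K.coe_nonneg]
      gcongr
      exact hK _
  have hbd : ∀ n, eLpNorm (w n) r μ ≤
      C * (eLpNorm (fderiv ℝ v) p μ + ENNReal.ofReal (c n * K) * eLpNorm v p μ) := by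
    intro n
    refine (hC _ (hw n) (hws n)).trans ?_
    gcongr
    have m1 : AEStronglyMeasurable (fun x => ‖fderiv ℝ v x‖) μ :=
      (hv.continuous_fderiv one_ne_zero).norm.aestronglyMeasurable
    have m2 : AEStronglyMeasurable (fun x => ‖(c n * K) • v x‖) μ :=
      (hv.continuous.const_smul (c n * (K : ℝ))).norm.aestronglyMeasurable
    calc eLpNorm (fderiv ℝ (w n)) p μ
        ≤ eLpNorm ((fun x => ‖fderiv ℝ v x‖) + fun x => ‖(c n * K) • v x‖) p μ :=
          eLpNorm_mono_real (hfd n)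
      _ ≤ eLpNorm (fun x => ‖fderiv ℝ v x‖) p μ + eLpNorm (fun x => ‖(c n * K) • v x‖) p μ :=
          eLpNorm_add_le m1 m2 (by exact_mod_cast hp)
      _ = _ := by
          rw [eLpNorm_norm, eLpNorm_norm (fun x => (c n * K) • v x)]
          congr 1
          refine (eLpNorm_const_smul (c n * (K : ℝ)) v p μ).trans ?_
          rw [Real.enorm_of_nonneg (mul_nonneg (hc0 n).le K.coe_nonneg)]
  have hlim : Tendsto (fun n => (C : ℝ≥0∞) *
      (eLpNorm (fderiv ℝ v) p μ + ENNReal.ofReal (c n * K) * eLpNorm v p μ)) atTop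
      (𝓝 (C * eLpNorm (fderiv ℝ v) p μ)) := by
    have h1 : Tendsto (fun n => ENNReal.ofReal (c n * K)) atTop (𝓝 0) := by
      simpa using ENNReal.tendsto_ofReal (hclim.mul_const (K : ℝ))
    have h2 := ENNReal.Tendsto.mul_const h1 (Or.inr hvp.eLpNorm_ne_top)
    have h3 := ENNReal.Tendsto.const_mul (a := (C : ℝ≥0∞))
      ((tendsto_const_nhds (x := eLpNorm (fderiv ℝ v) p μ)).add h2)
      (Or.inr ENNReal.coe_ne_top)
    simpa using h3
  refine (Lp.eLpNorm_lim_le_liminf_eLpNorm (f := w)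
    (fun n => (hw n).continuous.aestronglyMeasurable) v (Eventually.of_forall fun x => ?_)).trans ?_
  · have h1 : Tendsto (fun n => c n • x) atTop (𝓝 0) := by
      simpa using hclim.smul_const x
    have h2 : Tendsto (fun n => χ (c n • x)) atTop (𝓝 (χ 0)) :=
      (χ.continuous.tendsto 0).comp h1
    rw [χ.one_of_mem_closedBall (by simp [χ])] at h2
    simpa [w] using h2.mul_const (v x)
  · rw [← hlim.liminf_eq]
    exact liminf_le_liminf (Eventually.of_forall hbd)

end Mollification

section WeakGradient

variable {N : ℕ} {u : EuclideanSpace ℝ (Fin N) → ℝ}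
  {g : EuclideanSpace ℝ (Fin N) → EuclideanSpace ℝ (Fin N)}

/-- The gradient of a mollification is the mollification of the weak gradient. -/
theorem IsWeakGradient.fderiv_mollify (h : IsWeakGradient N u g)
    (hu : LocallyIntegrable u volume) (hg : LocallyIntegrable g volume)
    (ρ : ContDiffBump (0 : EuclideanSpace ℝ (Fin N))) (x : EuclideanSpace ℝ (Fin N)) :
    fderiv ℝ (ρ.mollify volume u) x = innerSL ℝ (ρ.mollify volume g x) := by
  have hρ : ContDiff ℝ ∞ (ρ.normed volume) := ρ.contDiff_normed
  have hd := (ρ.hasCompactSupport_normed (μ := volume)).hasFDerivAt_convolution_left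
    (ContinuousLinearMap.lsmul ℝ ℝ) (ρ.contDiff_normed (μ := volume) (n := 1)) hu x
  have hρ' : Continuous (fderiv ℝ (ρ.normed volume)) := hρ.continuous_fderiv (by simp)
  have hint := ((ρ.hasCompactSupport_normed (μ := volume)).fderiv ℝ).convolutionExists_left
    (ContinuousLinearMap.precompL (EuclideanSpace ℝ (Fin N)) (ContinuousLinearMap.lsmul ℝ ℝ))
    hρ' hu x
  refine ContinuousLinearMap.coe_injective
    ((EuclideanSpace.basisFun (Fin N) ℝ).toBasis.ext fun i => ?_)
  simp only [ContinuousLinearMap.coe_coe, OrthonormalBasis.coe_toBasis,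
    EuclideanSpace.basisFun_apply, innerSL_apply_apply]
  have hw := h (fun t => ρ.normed volume (x - t)) (hρ.comp (contDiff_const.sub contDiff_id))
    (ρ.hasCompactSupport_normed.comp_homeomorph (Homeomorph.subLeft x)) i
  have hf : ∀ t, fderiv ℝ (fun t => ρ.normed volume (x - t)) t (EuclideanSpace.single i 1) =
      -fderiv ℝ (ρ.normed volume) (x - t) (EuclideanSpace.single i 1) := by
    intro t
    have h1 : HasFDerivAt (fun t => x - t) (-ContinuousLinearMap.id ℝ (EuclideanSpace ℝ (Fin N))) t :=
      (hasFDerivAt_id t).const_sub x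
    have h2 := ((hρ.differentiable (by simp) (x - t)).hasFDerivAt).comp t h1
    rw [show (fun t => ρ.normed volume (x - t)) = ρ.normed volume ∘ fun t => x - t from rfl,
      h2.fderiv]
    simp
  simp only [hf, mul_neg, integral_neg, neg_inj] at hw
  have e1 : fderiv ℝ (ρ.mollify volume u) x (EuclideanSpace.single i 1) =
      ∫ t, u t * fderiv ℝ (ρ.normed volume) (x - t) (EuclideanSpace.single i 1) := by
    rw [ContDiffBump.mollify, hd.fderiv, convolution_def,
      ContinuousLinearMap.integral_apply hint.integrable,
      ← integral_sub_left_eq_self _ volume x]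
    refine integral_congr_ae (Eventually.of_forall fun t => ?_)
    simp [ContinuousLinearMap.precompL_apply, mul_comm]
  rw [e1, hw]
  have hint' : Integrable (fun t => ρ.normed volume (x - t) • g t) := by
    have := (ρ.integrable_normed_smul_comp_sub hg x).comp_sub_left x
    simpa using this
  rw [real_inner_comm, EuclideanSpace.inner_single_left, ρ.mollify_eq_swap]
  have := (EuclideanSpace.proj (𝕜 := ℝ) i).integral_comp_comm hint'
  simp only [map_one, one_mul]
  refine Eq.trans (integral_congr_ae (Eventually.of_forall fun t => ?_)) this
  exact mul_comm _ _

theorem IsWeakGradient.eLpNorm_fderiv_mollify_le (h : IsWeakGradient N u g) {p : ℝ≥0} (hp : 1 ≤ p)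
    (hu : LocallyIntegrable u volume) (hg : LocallyIntegrable g volume)
    (ρ : ContDiffBump (0 : EuclideanSpace ℝ (Fin N))) :
    eLpNorm (fderiv ℝ (ρ.mollify volume u)) p volume ≤ eLpNorm g p volume := by
  refine le_trans (le_of_eq ?_) (ρ.eLpNorm_mollify_le hp hg.aestronglyMeasurable)
  refine eLpNorm_congr_norm_ae (Eventually.of_forall fun x => ?_)
  rw [h.fderiv_mollify hu hg, innerSL_apply_norm]

/-- The Sobolev inequality on `ℝ^N`. -/
theorem exists_eLpNorm_le_eLpNorm_weakGradient {p r : ℝ≥0} (hp : 1 ≤ p) (hN : 0 < N)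
    (hr : (r : ℝ)⁻¹ = (p : ℝ)⁻¹ - (N : ℝ)⁻¹) :
    ∃ C : ℝ≥0, ∀ (u : EuclideanSpace ℝ (Fin N) → ℝ)
      (g : EuclideanSpace ℝ (Fin N) → EuclideanSpace ℝ (Fin N)), MemLp u p volume →
      MemLp g p volume → IsWeakGradient N u g → eLpNorm u r volume ≤ C * eLpNorm g p volume := by
  obtain ⟨C, hC⟩ := exists_eLpNorm_le_eLpNorm_fderiv
    (volume : Measure (EuclideanSpace ℝ (Fin N))) hp (by simpa using hN) (by simpa using hr)
  refine ⟨C, fun u g hu hg h => ?_⟩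
  have hp' : (1 : ℝ≥0∞) ≤ p := by exact_mod_cast hp
  have hu' : LocallyIntegrable u volume := hu.locallyIntegrable hp'
  have hg' : LocallyIntegrable g volume := hg.locallyIntegrable hp'
  let ρ := ContDiffBump.shrinking (EuclideanSpace ℝ (Fin N))
  have hs : ∀ n, ContDiff ℝ ∞ ((ρ n).mollify volume u) := fun n => (ρ n).contDiff_mollify hu'
  refine (Lp.eLpNorm_lim_le_liminf_eLpNorm (fun n => (hs n).continuous.aestronglyMeasurable) u
    (ContDiffBump.ae_tendsto_mollify_shrinking hu')).trans ?_
  refine liminf_le_of_le (by isBoundedDefault) fun b hb => ?_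
  obtain ⟨n, hn⟩ := hb.exists
  refine hn.trans ((hC _ ((hs n).of_le (by simp)) ⟨(hs n).continuous.aestronglyMeasurable, ?_⟩).trans ?_)
  · exact ((ρ n).eLpNorm_mollify_le hp hu.1).trans_lt hu.2
  · gcongr
    exact h.eLpNorm_fderiv_mollify_le hp hu' hg' (ρ n)

theorem IsWeakGradient.eLpNorm_comp_sub_sub_le (h : IsWeakGradient N u g) {p : ℝ≥0} (hp : 1 ≤ p)
    (hu : LocallyIntegrable u volume) (hg : LocallyIntegrable g volume)
    (y : EuclideanSpace ℝ (Fin N)) :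
    eLpNorm (fun x => u (x - y) - u x) p volume ≤ ‖y‖ₑ * eLpNorm g p volume := by
  let ρ := ContDiffBump.shrinking (EuclideanSpace ℝ (Fin N))
  have hs : ∀ n, ContDiff ℝ ∞ ((ρ n).mollify volume u) := fun n => (ρ n).contDiff_mollify hu
  have hae := ContDiffBump.ae_tendsto_mollify_shrinking hu
  have hae' : ∀ᵐ x, Tendsto (fun n => (ρ n).mollify volume u (x - y)) atTop (𝓝 (u (x - y))) :=
    (measurePreserving_sub_right volume y).quasiMeasurePreserving.ae hae
  refine (Lp.eLpNorm_lim_le_liminf_eLpNorm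
    (f := fun n x => (ρ n).mollify volume u (x - y) - (ρ n).mollify volume u x)
    (fun n => Continuous.aestronglyMeasurable ?_) _ ?_).trans ?_
  · exact ((hs n).continuous.comp (continuous_id.sub continuous_const)).sub (hs n).continuous
  · filter_upwards [hae, hae'] with x h1 h2 using h2.sub h1
  · refine liminf_le_of_le (by isBoundedDefault) fun b hb => ?_
    obtain ⟨n, hn⟩ := hb.exists
    refine hn.trans ((_root_.eLpNorm_comp_sub_sub_le hp ((hs n).of_le (by simp)) y).trans ?_)
    gcongr
    exact h.eLpNorm_fderiv_mollify_le hp hu hg (ρ n)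

theorem IsWeakGradient.eLpNorm_mollify_sub_le (h : IsWeakGradient N u g) {p : ℝ≥0} (hp : 1 ≤ p)
    (hu : LocallyIntegrable u volume) (hg : LocallyIntegrable g volume)
    (ρ : ContDiffBump (0 : EuclideanSpace ℝ (Fin N))) :
    eLpNorm (fun x => ρ.mollify volume u x - u x) p volume ≤
      ENNReal.ofReal ρ.rOut * eLpNorm g p volume := by
  refine ρ.eLpNorm_mollify_sub_le hp hu fun y hy => (h.eLpNorm_comp_sub_sub_le hp hu hg y).trans ?_
  gcongr
  rw [← ofReal_norm]
  exact ENNReal.ofReal_le_ofReal hy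

/-- The weak gradient is determined almost everywhere by the function. -/
theorem IsWeakGradient.ae_eq {u' : EuclideanSpace ℝ (Fin N) → ℝ}
    {g' : EuclideanSpace ℝ (Fin N) → EuclideanSpace ℝ (Fin N)} (h : IsWeakGradient N u g)
    (h' : IsWeakGradient N u' g') (hg : LocallyIntegrable g volume)
    (hg' : LocallyIntegrable g' volume) (huu' : u =ᵐ[volume] u') : g =ᵐ[volume] g' := by
  suffices ∀ i, ∀ᵐ x, g x i - g' x i = 0 by
    filter_upwards [ae_all_iff.2 this] with x hx
    ext i
    exact sub_eq_zero.1 (hx i)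
  intro i
  have hi : ∀ {f : EuclideanSpace ℝ (Fin N) → EuclideanSpace ℝ (Fin N)},
      LocallyIntegrable f volume → LocallyIntegrable (fun x => f x i) volume := fun hf x => by
    obtain ⟨s, hs, hfs⟩ := hf x
    exact ⟨s, hs, (EuclideanSpace.proj (𝕜 := ℝ) i).integrable_comp hfs⟩
  refine ae_eq_zero_of_integral_contDiff_smul_eq_zero ((hi hg).sub (hi hg')) fun φ hφ hs => ?_
  have e := h φ hφ hs i
  have e' := h' φ hφ hs i
  have e3 : ∫ x, u x * fderiv ℝ φ x (EuclideanSpace.single i 1) =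
      ∫ x, u' x * fderiv ℝ φ x (EuclideanSpace.single i 1) := by
    refine integral_congr_ae ?_
    filter_upwards [huu'] with x hx
    rw [hx]
  have hint : ∀ {f : EuclideanSpace ℝ (Fin N) → EuclideanSpace ℝ (Fin N)},
      LocallyIntegrable f volume → Integrable (fun x => f x i * φ x) volume := fun hf => by
    simpa [mul_comm] using
      (hi hf).integrable_smul_left_of_hasCompactSupport hφ.continuous hs
  have e4 : ∫ x, g x i * φ x - g' x i * φ x = 0 := by
    rw [integral_sub (hint hg) (hint hg')]
    linarith
  rw [← e4]
  exact integral_congr_ae (Eventually.of_forall fun x => by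
    simp only [smul_eq_mul]; ring)

/-- The classical gradient of a test function is its weak gradient. -/
theorem isWeakGradient_of_contDiff {v : EuclideanSpace ℝ (Fin N) → ℝ} (hv : ContDiff ℝ 1 v) :
    IsWeakGradient N v fun x => gradient v x := by
  intro φ hφ hs i
  have hv' : Continuous fun x => fderiv ℝ v x (EuclideanSpace.single i 1) :=
    (hv.continuous_fderiv one_ne_zero).clm_apply continuous_const
  have hφ' : Continuous fun x => fderiv ℝ φ x (EuclideanSpace.single i 1) :=
    (hφ.continuous_fderiv (by simp)).clm_apply continuous_const
  have hs' : HasCompactSupport fun x => fderiv ℝ φ x (EuclideanSpace.single i 1) :=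
    hs.fderiv_apply (𝕜 := ℝ) _
  rw [integral_mul_fderiv_eq_neg_fderiv_mul_of_integrable]
  · congr 1
    refine integral_congr_ae (Eventually.of_forall fun x => ?_)
    have : gradient v x i = fderiv ℝ v x (EuclideanSpace.single i 1) := by
      rw [← toDual_gradient, InnerProductSpace.toDual_apply_apply, real_inner_comm,
        EuclideanSpace.inner_single_left]
      simp
    simp only [this]
  · exact (hv'.mul hφ.continuous).integrable_of_hasCompactSupport hs.mul_left
  · exact (hv.continuous.mul hφ').integrable_of_hasCompactSupport hs'.mul_left
  · exact (hv.continuous.mul hφ.continuous).integrable_of_hasCompactSupport hs.mul_left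
  · exact fun x _ => hv.differentiable one_ne_zero x
  · exact fun x _ => hφ.differentiable (by simp) x

end WeakGradient

section WeakConvergence

variable {X : Type*} [NormedAddCommGroup X] [NormedSpace ℝ X]

theorem tendsto_toWeakSpace_zero_iff {v : ℕ → X} :
    Tendsto (fun k => toWeakSpace ℝ X (v k)) atTop (𝓝 0) ↔
      ∀ f : X →L[ℝ] ℝ, Tendsto (fun k => f (v k)) atTop (𝓝 0) := by
  have hinj : Function.Injective (topDualPairing ℝ X).flip := fun x y hxy =>
    (SeparatingDual.eq_iff_forall_dual_eq (R := ℝ)).2 fun f => LinearMap.congr_fun hxy f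
  have h := WeakBilin.tendsto_iff_forall_eval_tendsto (topDualPairing ℝ X).flip (l := atTop)
    (f := v) (x := 0) hinj
  refine h.trans (forall_congr' fun f => ?_)
  change Tendsto (fun k => f (v k)) atTop (𝓝 (f 0)) ↔ _
  rw [map_zero]

theorem exists_norm_le_of_tendsto_dual {v : ℕ → X}
    (h : ∀ f : X →L[ℝ] ℝ, Tendsto (fun k => f (v k)) atTop (𝓝 0)) : ∃ M : ℝ, ∀ k, ‖v k‖ ≤ M := by
  obtain ⟨M, hM⟩ := banach_steinhaus (g := fun k => NormedSpace.inclusionInDoubleDual ℝ X (v k))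
    fun f => by
      obtain ⟨C, hC⟩ := (h f).norm.bddAbove_range
      exact ⟨C, fun k => hC ⟨k, rfl⟩⟩
  exact ⟨M, fun k => by
    simpa using (NormedSpace.inclusionInDoubleDualLi (E := X) ℝ).norm_map (v k) ▸ hM k⟩

end WeakConvergence

theorem exists_interpolation_exponent {p q : ℝ≥0} {r : ℝ≥0∞} (hp : 0 < p) (hpq : p < q)
    (hqr : (q : ℝ≥0∞) < r) : ∃ θ : ℝ, 0 < θ ∧ θ < 1 ∧
      (q : ℝ≥0∞)⁻¹ = ENNReal.ofReal (1 - θ) * (p : ℝ≥0∞)⁻¹ + ENNReal.ofReal θ * r⁻¹ := by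
  have hq : 0 < q := hp.trans hpq
  have hrtop : r⁻¹ ≠ ⊤ := by
    rw [ENNReal.inv_ne_top]
    exact (pos_of_gt hqr).ne'
  set s := r⁻¹.toReal with hs
  have hsr : r⁻¹ = ENNReal.ofReal s := (ENNReal.ofReal_toReal hrtop).symm
  have hs0 : 0 ≤ s := ENNReal.toReal_nonneg
  have hi : ∀ {t : ℝ≥0}, 0 < t → (t : ℝ≥0∞)⁻¹ = ENNReal.ofReal (t : ℝ)⁻¹ := fun {t} ht => by
    rw [ENNReal.ofReal_inv_of_pos (by exact_mod_cast ht), ENNReal.ofReal_coe_nnreal]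
  have h1 : s < (q : ℝ)⁻¹ := by
    have := ENNReal.inv_lt_inv.2 hqr
    rw [hi hq, hsr] at this
    exact (ENNReal.ofReal_lt_ofReal_iff (by positivity)).1 this
  have h2 : (q : ℝ)⁻¹ < (p : ℝ)⁻¹ := inv_strictAnti₀ (by exact_mod_cast hp) (by exact_mod_cast hpq)
  have h3 : 0 < (p : ℝ)⁻¹ - s := by linarith
  have hθ0 : 0 < ((p : ℝ)⁻¹ - (q : ℝ)⁻¹) / ((p : ℝ)⁻¹ - s) := div_pos (by linarith) h3
  have hθ1 : ((p : ℝ)⁻¹ - (q : ℝ)⁻¹) / ((p : ℝ)⁻¹ - s) < 1 := (div_lt_one h3).2 (by linarith)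
  refine ⟨_, hθ0, hθ1, ?_⟩
  rw [hi hq, hi hp, hsr, ← ENNReal.ofReal_mul (by linarith), ← ENNReal.ofReal_mul hθ0.le,
    ← ENNReal.ofReal_add (mul_nonneg (by linarith) (by positivity)) (by positivity)]
  congr 1
  linear_combination div_mul_cancel₀ ((p : ℝ)⁻¹ - (q : ℝ)⁻¹) h3.ne'

section Embedding

variable {N : ℕ} {p : ℝ≥0} [Fact (1 ≤ (p : ℝ≥0∞))]

theorem one_le_of_fact (p : ℝ≥0) [h : Fact (1 ≤ (p : ℝ≥0∞))] : 1 ≤ p := by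
  exact_mod_cast h.out

theorem isWeakGradient_sobolev (u : SobolevW1 N p) :
    IsWeakGradient N (sobolevFun u) (sobolevGrad u) := u.2

theorem locallyIntegrable_coeFn_Lp {F : Type*} [NormedAddCommGroup F]
    (w : Lp F p (volume : Measure (EuclideanSpace ℝ (Fin N)))) :
    LocallyIntegrable (fun x => w x) volume :=
  (Lp.memLp w).locallyIntegrable Fact.out

theorem eLpNorm_sobolevFun_le (u : SobolevW1 N p) : eLpNorm (sobolevFun u) p volume ≤ ‖u‖ₑ := by
  rw [← Lp.enorm_def]
  exact WithLp.enorm_fst_le _ u.1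

theorem eLpNorm_sobolevGrad_le (u : SobolevW1 N p) : eLpNorm (sobolevGrad u) p volume ≤ ‖u‖ₑ := by
  rw [← Lp.enorm_def]
  exact WithLp.enorm_snd_le _ u.1

theorem eLpNorm_le_of_endpoints {α E : Type*} [MeasurableSpace α] [NormedAddCommGroup E]
    {μ : Measure α} {q r : ℝ≥0} (hp : 0 < p) (hpq : p ≤ q) (hqr : q ≤ r)
    {f : α → E} (hf : AEStronglyMeasurable f μ) {A : ℝ≥0∞} (h1 : eLpNorm f p μ ≤ A)
    (h2 : eLpNorm f r μ ≤ A) : eLpNorm f q μ ≤ A := by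
  rcases hpq.eq_or_lt with rfl | hpq
  · exact h1
  rcases hqr.eq_or_lt with rfl | hqr
  · exact h2
  obtain ⟨θ, h0, h1', h⟩ := exists_interpolation_exponent hp hpq
    (show (q : ℝ≥0∞) < r by exact_mod_cast hqr)
  calc eLpNorm f q μ ≤ eLpNorm f p μ ^ (1 - θ) * eLpNorm f r μ ^ θ :=
        eLpNorm_le_eLpNorm_rpow_mul_eLpNorm_rpow h0 h1' h hf
    _ ≤ A ^ (1 - θ) * A ^ θ := by
        gcongr
    _ = A := by
        rw [← ENNReal.rpow_add_of_nonneg _ _ (by linarith) h0.le]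
        simp

theorem exists_eLpNorm_sobolevFun_le {q r : ℝ≥0} (hN : 0 < N)
    (hr : (r : ℝ)⁻¹ = (p : ℝ)⁻¹ - (N : ℝ)⁻¹) (hpq : p ≤ q) (hqr : q ≤ r) :
    ∃ C : ℝ≥0, ∀ u : SobolevW1 N p, eLpNorm (sobolevFun u) q volume ≤ C * ‖u‖ₑ := by
  have hp := one_le_of_fact p
  obtain ⟨C, hC⟩ := exists_eLpNorm_le_eLpNorm_weakGradient hp hN hr
  refine ⟨max 1 C, fun u => eLpNorm_le_of_endpoints (zero_lt_one.trans_le hp) hpq hqr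
    (Lp.aestronglyMeasurable _) ?_ ?_⟩
  · refine (eLpNorm_sobolevFun_le u).trans (le_mul_of_one_le_left zero_le ?_)
    exact_mod_cast le_max_left _ _
  · refine (hC _ _ (Lp.memLp _) (Lp.memLp _) (isWeakGradient_sobolev u)).trans ?_
    gcongr
    · exact le_max_right _ _
    · exact eLpNorm_sobolevGrad_le u

theorem exists_sobolev_embedding {q r : ℝ≥0} [Fact (1 ≤ (q : ℝ≥0∞))] (hN : 0 < N)
    (hr : (r : ℝ)⁻¹ = (p : ℝ)⁻¹ - (N : ℝ)⁻¹) (hpq : p ≤ q) (hqr : q ≤ r) :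
    ∃ ι : SobolevW1 N p →L[ℝ] Lp ℝ q (volume : Measure (EuclideanSpace ℝ (Fin N))),
      ∀ u, ι u =ᵐ[volume] sobolevFun u := by
  obtain ⟨C, hC⟩ := exists_eLpNorm_sobolevFun_le hN hr hpq hqr
  have hm : ∀ u : SobolevW1 N p, MemLp (sobolevFun u) q volume := fun u =>
    ⟨Lp.aestronglyMeasurable _, (hC u).trans_lt (ENNReal.mul_lt_top ENNReal.coe_lt_top
      enorm_lt_top)⟩
  let L : SobolevW1 N p →ₗ[ℝ] Lp ℝ q (volume : Measure (EuclideanSpace ℝ (Fin N))) :=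
    { toFun := fun u => (hm u).toLp _
      map_add' := fun u v => by
        rw [← MemLp.toLp_add]
        exact MemLp.toLp_congr _ _ (Lp.coeFn_add (sobolevFun u) (sobolevFun v))
      map_smul' := fun c u => by
        rw [RingHom.id_apply, ← MemLp.toLp_const_smul]
        exact MemLp.toLp_congr _ _ (Lp.coeFn_smul c (sobolevFun u)) }
  refine ⟨L.mkContinuous C fun u => ?_, fun u => (hm u).coeFn_toLp⟩
  have h : ‖L u‖ₑ ≤ C * ‖u‖ₑ := by
    refine (Lp.enorm_toLp (hf := hm u)).trans_le (hC u)
  have h' : ‖L u‖₊ ≤ C * ‖u‖₊ := by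
    rw [enorm_eq_nnnorm, enorm_eq_nnnorm] at h
    exact_mod_cast h
  exact_mod_cast h'

theorem injective_of_ae_eq_sobolevFun {q : ℝ≥0∞}
    {ι : SobolevW1 N p → Lp ℝ q (volume : Measure (EuclideanSpace ℝ (Fin N)))}
    (hι : ∀ u, ι u =ᵐ[volume] sobolevFun u) : Function.Injective ι := by
  intro u v huv
  have h1 : sobolevFun u =ᵐ[volume] sobolevFun v := (hι u).symm.trans (huv ▸ hι v)
  have h2 := (isWeakGradient_sobolev u).ae_eq (isWeakGradient_sobolev v)
    (locallyIntegrable_coeFn_Lp _) (locallyIntegrable_coeFn_Lp _) h1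
  apply Subtype.ext
  apply (WithLp.equiv (p : ℝ≥0∞) _).injective
  exact Prod.ext (Lp.ext h1) (Lp.ext h2)

theorem uniformlyConvexPow_sobolev (hp : 1 < p) : UniformlyConvexPow (SobolevW1 N p) p := by
  have hp' : (1 : ℝ) < p := by exact_mod_cast hp
  exact ((uniformlyConvexPow_Lp (uniformlyConvexPow_of_finiteDimensional hp')).withLp_prod
    (uniformlyConvexPow_Lp (uniformlyConvexPow_of_finiteDimensional hp'))).submodule _

end Embedding

section Shifts

variable {N : ℕ} {p : ℝ≥0} [Fact (1 ≤ (p : ℝ≥0∞))]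

theorem sobolevFun_sobolevShift_ae_eq (y : Fin N → ℤ) (u : SobolevW1 N p) :
    sobolevFun (sobolevShift p y u) =ᵐ[volume] fun x => sobolevFun u (x - latticePoint y) :=
  coeFn_lpShift _ y (sobolevFun u)

theorem lpShift_zero {F : Type*} [NormedAddCommGroup F] [NormedSpace ℝ F]
    (w : Lp F p (volume : Measure (EuclideanSpace ℝ (Fin N)))) : lpShift p F 0 w = w := by
  refine Lp.ext ((coeFn_lpShift _ 0 w).trans (Eventually.of_forall fun x => ?_))
  have : latticePoint (0 : Fin N → ℤ) = 0 := by
    ext i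
    simp [latticePoint]
  simp only [this, sub_zero]

theorem isGaugeSet_latticeShifts : IsGaugeSet (latticeShifts N (p : ℝ≥0∞)) where
  isBounded := by
    refine (isBounded_iff_forall_norm_le
      (E := SobolevW1 N (p : ℝ≥0∞) →L[ℝ] SobolevW1 N (p : ℝ≥0∞))).2 ⟨1, ?_⟩
    rintro _ ⟨y, rfl⟩
    exact (sobolevShift (p : ℝ≥0∞) y).norm_toContinuousLinearMap_le
  id_mem := by
    refine ⟨0, ContinuousLinearMap.ext fun u => Subtype.ext ?_⟩
    apply (WithLp.equiv (p : ℝ≥0∞) _).injective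
    exact Prod.ext (lpShift_zero _) (lpShift_zero _)

theorem eLpNorm_sobolevFun_sobolevShift (q : ℝ≥0∞) (y : Fin N → ℤ) (u : SobolevW1 N p) :
    eLpNorm (sobolevFun (sobolevShift p y u)) q volume = eLpNorm (sobolevFun u) q volume :=
  (eLpNorm_congr_ae (sobolevFun_sobolevShift_ae_eq y u)).trans
    (ContDiffBump.eLpNorm_comp_sub_right (Lp.aestronglyMeasurable _) q _)

theorem norm_eq_of_ae_eq_sobolevFun {q : ℝ≥0∞}
    {ι : SobolevW1 N p → Lp ℝ q (volume : Measure (EuclideanSpace ℝ (Fin N)))}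
    (hι : ∀ u, ι u =ᵐ[volume] sobolevFun u) (u : SobolevW1 N p) :
    ‖ι u‖ = (eLpNorm (sobolevFun u) q volume).toReal := by
  rw [Lp.norm_def, eLpNorm_congr_ae (hι u)]

theorem tendsto_norm_iff_tendsto_eLpNorm {q : ℝ≥0∞}
    {ι : SobolevW1 N p → Lp ℝ q (volume : Measure (EuclideanSpace ℝ (Fin N)))}
    (hι : ∀ u, ι u =ᵐ[volume] sobolevFun u) (u : ℕ → SobolevW1 N p) :
    Tendsto (fun k => ‖ι (u k)‖) atTop (𝓝 0) ↔
      Tendsto (fun k => eLpNorm (sobolevFun (u k)) q volume) atTop (𝓝 0) := by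
  simp only [norm_eq_of_ae_eq_sobolevFun hι]
  exact ENNReal.tendsto_toReal_zero_iff fun k => by
    rw [← eLpNorm_congr_ae (hι (u k))]
    exact Lp.eLpNorm_ne_top _

/-- A bounded sequence that vanishes in some `L^q` with `p ≤ q ≤ p^*` vanishes weakly along all
lattice shifts. -/
theorem gaugeWeakToZero_of_tendsto_eLpNorm (hp : 1 < p) {q r : ℝ≥0} (hN : 0 < N)
    (hr : (r : ℝ)⁻¹ = (p : ℝ)⁻¹ - (N : ℝ)⁻¹) (hpq : p ≤ q) (hqr : q ≤ r)
    {u : ℕ → SobolevW1 N p} (hu : Bornology.IsBounded (Set.range u))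
    (h : Tendsto (fun k => eLpNorm (sobolevFun (u k)) q volume) atTop (𝓝 0)) :
    GaugeWeakToZero (latticeShifts N (p : ℝ≥0∞)) u := by
  have : Fact (1 ≤ (q : ℝ≥0∞)) := ⟨by exact_mod_cast hp.le.trans hpq⟩
  obtain ⟨ι, hι⟩ := exists_sobolev_embedding (N := N) (p := p) (q := q) hN hr hpq hqr
  intro g hg
  choose y hy using hg
  have hgu : ∀ k, g k (u k) = sobolevShift p (y k) (u k) := fun k => by
    rw [← hy k]
    rfl
  simp only [hgu]
  rw [tendsto_toWeakSpace_zero_iff]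
  refine (uniformlyConvexPow_sobolev hp).tendsto_apply_of_injective (by exact_mod_cast hp.le)
    (injective_of_ae_eq_sobolevFun hι) ?_ ?_
  · obtain ⟨M, hM⟩ := hu.exists_norm_le
    refine isBounded_iff_forall_norm_le.2 ⟨M, ?_⟩
    rintro _ ⟨k, rfl⟩
    simpa using hM (u k) ⟨k, rfl⟩
  · rw [tendsto_norm_iff_tendsto_eLpNorm hι]
    simpa only [eLpNorm_sobolevFun_sobolevShift] using h

end Shifts

section MollifyBounds

variable {E F : Type*} [NormedAddCommGroup E] [NormedSpace ℝ E] [FiniteDimensional ℝ E]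
  [MeasurableSpace E] [BorelSpace E] {μ : Measure E} [μ.IsAddHaarMeasure]
  [NormedAddCommGroup F] [NormedSpace ℝ F]

namespace ContDiffBump

variable (ρ : ContDiffBump (0 : E))

theorem exists_normed_le (μ : Measure E) [μ.IsAddHaarMeasure] :
    ∃ S : ℝ≥0, ∀ y, ρ.normed μ y ≤ S := by
  obtain ⟨S, hS⟩ := (ρ.continuous_normed (μ := μ)).bounded_above_of_compact_support
    ρ.hasCompactSupport_normed
  exact ⟨S.toNNReal, fun y => (le_abs_self _).trans ((hS y).trans (Real.le_coe_toNNReal S))⟩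

/-- Pointwise bound for a mollification by the `L^p` norm. -/
theorem enorm_mollify_le {p : ℝ≥0} (hp : 1 ≤ p) {S : ℝ≥0} (hS : ∀ y, ρ.normed μ y ≤ S)
    {w : E → F} (hw : AEStronglyMeasurable w μ) (x : E) :
    ‖ρ.mollify μ w x‖ₑ ≤ (S : ℝ≥0∞) ^ (1 / (p : ℝ)) * eLpNorm w p μ := by
  have hp0 : 0 < p := zero_lt_one.trans_le hp
  have hp0' : (0 : ℝ) < p := hp0
  have hm := aestronglyMeasurable_comp_const_sub hw x
  rw [← ENNReal.rpow_le_rpow_iff hp0', ENNReal.mul_rpow_of_nonneg _ _ hp0'.le,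
    ← ENNReal.rpow_mul, one_div_mul_cancel hp0'.ne', ENNReal.rpow_one,
    eLpNorm_nnreal_pow_eq_lintegral hp0.ne']
  calc ‖ρ.mollify μ w x‖ₑ ^ (p : ℝ) ≤ (∫⁻ y, ‖w (x - y)‖ₑ ∂(ρ.toMeasure μ)) ^ (p : ℝ) := by
        gcongr
        exact ρ.enorm_integral_normed_smul_le hm
    _ ≤ ∫⁻ y, ‖w (x - y)‖ₑ ^ (p : ℝ) ∂(ρ.toMeasure μ) :=
        lintegral_rpow_le_lintegral_rpow (by exact_mod_cast hp)
          (hm.enorm.mono_ac ρ.toMeasure_absolutelyContinuous)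
    _ = ∫⁻ y, ENNReal.ofReal (ρ.normed μ y) * ‖w (x - y)‖ₑ ^ (p : ℝ) ∂μ :=
        ρ.lintegral_toMeasure (hm.enorm.pow_const _)
    _ ≤ ∫⁻ y, S * ‖w (x - y)‖ₑ ^ (p : ℝ) ∂μ := by
        refine lintegral_mono fun y => ?_
        gcongr
        exact ENNReal.ofReal_le_of_le_toReal (by simpa using hS y)
    _ = S * ∫⁻ y, ‖w y‖ₑ ^ (p : ℝ) ∂μ := by
        rw [lintegral_const_mul' _ _ ENNReal.coe_ne_top,
          lintegral_sub_left_eq_self (fun y => ‖w y‖ₑ ^ (p : ℝ)) x]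

theorem mollify_congr {u v : E → F} (h : u =ᵐ[μ] v) (x : E) :
    ρ.mollify μ u x = ρ.mollify μ v x := by
  rw [mollify_eq_swap, mollify_eq_swap]
  refine integral_congr_ae ?_
  filter_upwards [h] with y hy
  rw [hy]

theorem mollify_comp_sub (u : E → F) (a x : E) :
    ρ.mollify μ (fun z => u (z - a)) x = ρ.mollify μ u (x - a) := by
  simp only [mollify, MeasureTheory.convolution_def, sub_right_comm]

end ContDiffBump

end MollifyBounds

section Cocompactness

variable {N : ℕ} {p : ℝ≥0} [Fact (1 ≤ (p : ℝ≥0∞))]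

/-- The evaluation at `x` of the mollification, as a bounded linear functional on `W^{1,p}`. -/
theorem exists_mollify_functional (ρ : ContDiffBump (0 : EuclideanSpace ℝ (Fin N)))
    (x : EuclideanSpace ℝ (Fin N)) :
    ∃ f : SobolevW1 N p →L[ℝ] ℝ, ∀ u, f u = ρ.mollify volume (sobolevFun u) x := by
  obtain ⟨S, hS⟩ := ρ.exists_normed_le volume
  have hp := one_le_of_fact p
  have hint : ∀ u : SobolevW1 N p, Integrable (fun y => ρ.normed volume (x - y) • sobolevFun u y) :=
    fun u => by
      simpa using (ρ.integrable_normed_smul_comp_sub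
        (locallyIntegrable_coeFn_Lp (sobolevFun u)) x).comp_sub_left x
  let L : SobolevW1 N p →ₗ[ℝ] ℝ :=
    { toFun := fun u => ρ.mollify volume (sobolevFun u) x
      map_add' := fun u v => by
        rw [show sobolevFun (u + v) = sobolevFun u + sobolevFun v from rfl,
          ρ.mollify_congr (Lp.coeFn_add (sobolevFun u) (sobolevFun v)), ρ.mollify_eq_swap,
          ρ.mollify_eq_swap, ρ.mollify_eq_swap, ← integral_add (hint u) (hint v)]
        simp only [Pi.add_apply, smul_add]
      map_smul' := fun c u => by
        rw [show sobolevFun (c • u) = c • sobolevFun u from rfl,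
          ρ.mollify_congr (Lp.coeFn_smul c (sobolevFun u)), ρ.mollify_eq_swap,
          ρ.mollify_eq_swap, RingHom.id_apply, ← integral_smul]
        simp only [Pi.smul_apply, smul_comm c] }
  refine ⟨L.mkContinuous ((S : ℝ≥0) ^ (1 / (p : ℝ)) : ℝ≥0) fun u => ?_, fun u => rfl⟩
  have h : ‖L u‖ₑ ≤ ((S ^ (1 / (p : ℝ)) : ℝ≥0) : ℝ≥0∞) * ‖u‖ₑ := by
    rw [ENNReal.coe_rpow_of_nonneg _ (by positivity)]
    refine (ρ.enorm_mollify_le hp hS (Lp.aestronglyMeasurable (sobolevFun u)) x).trans ?_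
    gcongr
    exact eLpNorm_sobolevFun_le u
  have h' : ‖L u‖₊ ≤ S ^ (1 / (p : ℝ)) * ‖u‖₊ := by
    rw [enorm_eq_nnnorm, enorm_eq_nnnorm] at h
    exact_mod_cast h
  exact_mod_cast h'

/-- Mollifications of bounded sequences are uniformly Lipschitz. -/
theorem exists_lipschitzWith_mollify (ρ : ContDiffBump (0 : EuclideanSpace ℝ (Fin N))) (M : ℝ) :
    ∃ K : ℝ≥0, ∀ u : SobolevW1 N p, ‖u‖ ≤ M →
      LipschitzWith K (ρ.mollify volume (sobolevFun u)) := by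
  obtain ⟨S, hS⟩ := ρ.exists_normed_le volume
  have hp := one_le_of_fact p
  refine ⟨S ^ (1 / (p : ℝ)) * M.toNNReal, fun u hu => ?_⟩
  have hu' := locallyIntegrable_coeFn_Lp (sobolevFun u)
  have hg' := locallyIntegrable_coeFn_Lp (sobolevGrad u)
  refine lipschitzWith_of_nnnorm_fderiv_le (𝕜 := ℝ)
    ((ρ.contDiff_mollify hu').differentiable (by simp)) fun x => ?_
  rw [(isWeakGradient_sobolev u).fderiv_mollify hu' hg' ρ x]
  have h := ρ.enorm_mollify_le hp hS hg'.aestronglyMeasurable x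
  have h2 : ‖ρ.mollify volume (sobolevGrad u) x‖ₑ ≤
      ((S ^ (1 / (p : ℝ)) * M.toNNReal : ℝ≥0) : ℝ≥0∞) := by
    refine h.trans ?_
    rw [ENNReal.coe_mul, ENNReal.coe_rpow_of_nonneg _ (by positivity)]
    gcongr
    refine (eLpNorm_sobolevGrad_le u).trans ?_
    rw [← ofReal_norm]
    exact ENNReal.ofReal_le_ofReal hu
  rw [enorm_eq_nnnorm] at h2
  have h3 : ‖ρ.mollify volume (sobolevGrad u) x‖₊ ≤ S ^ (1 / (p : ℝ)) * M.toNNReal := by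
    exact_mod_cast h2
  refine le_trans (le_of_eq ?_) h3
  exact NNReal.eq (innerSL_apply_norm ..)

theorem exists_latticePoint_sub_mem (x : EuclideanSpace ℝ (Fin N)) :
    ∃ y : Fin N → ℤ, x - latticePoint y ∈ Metric.closedBall 0 (Real.sqrt N) := by
  refine ⟨fun i => ⌊x i⌋, ?_⟩
  rw [mem_closedBall_zero_iff, EuclideanSpace.norm_eq]
  refine Real.sqrt_le_sqrt ?_
  have h : ∀ i, ‖(x - latticePoint fun i => ⌊x i⌋) i‖ ^ 2 ≤ 1 := fun i => by
    have e : (x - latticePoint fun i => ⌊x i⌋) i = Int.fract (x i) := by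
      simp [latticePoint]
    rw [e, Real.norm_of_nonneg (Int.fract_nonneg _)]
    exact pow_le_one₀ (Int.fract_nonneg _) (Int.fract_lt_one _).le
  calc _ ≤ ∑ _i : Fin N, (1 : ℝ) := Finset.sum_le_sum fun i _ => h i
    _ = N := by simp

theorem latticePoint_neg (y : Fin N → ℤ) : latticePoint (-y) = -latticePoint y := by
  ext i
  simp [latticePoint]

theorem GaugeWeakToZero.tendsto_mollify {u : ℕ → SobolevW1 N p}
    (hu : GaugeWeakToZero (latticeShifts N (p : ℝ≥0∞)) u) {M : ℝ} (hM : ∀ k, ‖u k‖ ≤ M)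
    (ρ : ContDiffBump (0 : EuclideanSpace ℝ (Fin N))) (x : ℕ → EuclideanSpace ℝ (Fin N)) :
    Tendsto (fun k => ρ.mollify volume (sobolevFun (u k)) (x k)) atTop (𝓝 0) := by
  choose y hy using fun k => exists_latticePoint_sub_mem (x k)
  let v : ℕ → SobolevW1 N p := fun k => sobolevShift p (-y k) (u k)
  have hv : ∀ f : SobolevW1 N p →L[ℝ] ℝ, Tendsto (fun k => f (v k)) atTop (𝓝 0) :=
    tendsto_toWeakSpace_zero_iff.1
      (hu (fun k => (sobolevShift p (-y k)).toContinuousLinearMap) fun k => ⟨-y k, rfl⟩)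
  obtain ⟨K, hK⟩ := exists_lipschitzWith_mollify (p := p) ρ M
  have hvK : ∀ k, LipschitzWith K (ρ.mollify volume (sobolevFun (v k))) := fun k =>
    hK _ (by simpa [v] using hM k)
  have hvt : ∀ t, Tendsto (fun k => ρ.mollify volume (sobolevFun (v k)) t) atTop (𝓝 0) := by
    intro t
    obtain ⟨f, hf⟩ := exists_mollify_functional (p := p) ρ t
    simpa only [hf] using hv f
  have hux : ∀ k, ρ.mollify volume (sobolevFun (u k)) (x k) =
      ρ.mollify volume (sobolevFun (v k)) (x k - latticePoint (y k)) := by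
    intro k
    rw [ρ.mollify_congr (sobolevFun_sobolevShift_ae_eq (-y k) (u k)), ρ.mollify_comp_sub,
      latticePoint_neg, sub_neg_eq_add, sub_add_cancel]
  simp only [hux]
  refine tendsto_of_subseq_tendsto fun ns hns => ?_
  obtain ⟨t, -, φ, hφ, ht⟩ := (isCompact_closedBall (0 : EuclideanSpace ℝ (Fin N))
    (Real.sqrt N)).tendsto_subseq fun k => hy (ns k)
  refine ⟨φ, ?_⟩
  have h1 := (hvt t).comp (hns.comp hφ.tendsto_atTop)
  have h2 : Tendsto (fun k => K * dist (x (ns (φ k)) - latticePoint (y (ns (φ k)))) t) atTop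
      (𝓝 0) := by
    simpa using (tendsto_iff_dist_tendsto_zero.1 ht).const_mul (K : ℝ)
  refine (tendsto_iff_of_dist (squeeze_zero (fun _ => dist_nonneg) (fun k => ?_) h2)).2 h1
  exact (hvK _).dist_le_mul _ _

theorem GaugeWeakToZero.eventually_mollify_le {u : ℕ → SobolevW1 N p}
    (hu : GaugeWeakToZero (latticeShifts N (p : ℝ≥0∞)) u) {M : ℝ} (hM : ∀ k, ‖u k‖ ≤ M)
    (ρ : ContDiffBump (0 : EuclideanSpace ℝ (Fin N))) {δ : ℝ} (hδ : 0 < δ) :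
    ∀ᶠ k in atTop, ∀ x, ‖ρ.mollify volume (sobolevFun (u k)) x‖ ≤ δ := by
  by_contra hcon
  have hex : ∀ k, ∃ x, (∃ z, δ < ‖ρ.mollify volume (sobolevFun (u k)) z‖) →
      δ < ‖ρ.mollify volume (sobolevFun (u k)) x‖ := fun k => by
    by_cases h : ∃ z, δ < ‖ρ.mollify volume (sobolevFun (u k)) z‖
    · exact ⟨h.choose, fun _ => h.choose_spec⟩
    · exact ⟨0, fun h' => absurd h' h⟩
  choose x hx using hex
  refine hcon ?_
  have h := (hu.tendsto_mollify hM ρ x).norm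
  rw [norm_zero] at h
  filter_upwards [h.eventually_lt_const hδ] with k hk
  by_contra! h'
  exact absurd (hx k h') (not_lt.2 hk.le)

theorem GaugeWeakToZero.exists_norm_le {u : ℕ → SobolevW1 N p}
    (hu : GaugeWeakToZero (latticeShifts N (p : ℝ≥0∞)) u) : ∃ M : ℝ, ∀ k, ‖u k‖ ≤ M :=
  exists_norm_le_of_tendsto_dual (tendsto_toWeakSpace_zero_iff.1
    (hu (fun _ => ContinuousLinearMap.id ℝ _) fun _ => isGaugeSet_latticeShifts.id_mem))

/-- Sequences that vanish weakly along all lattice shifts vanish in `L^q` for `p < q < p^*`. -/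
theorem GaugeWeakToZero.tendsto_eLpNorm {u : ℕ → SobolevW1 N p}
    (hu : GaugeWeakToZero (latticeShifts N (p : ℝ≥0∞)) u) {q r : ℝ≥0} (hN : 0 < N)
    (hr : (r : ℝ)⁻¹ = (p : ℝ)⁻¹ - (N : ℝ)⁻¹) (hpq : p < q) (hqr : q < r) :
    Tendsto (fun k => eLpNorm (sobolevFun (u k)) q volume) atTop (𝓝 0) := by
  have hp := one_le_of_fact p
  have hp0 : 0 < p := zero_lt_one.trans_le hp
  have hq1 : (1 : ℝ≥0∞) ≤ q := by exact_mod_cast hp.trans hpq.le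
  have hr1 : 1 ≤ r := hp.trans (hpq.trans hqr).le
  obtain ⟨M, hM⟩ := hu.exists_norm_le
  obtain ⟨C, hC⟩ := exists_eLpNorm_sobolevFun_le (N := N) (p := p) hN hr (hpq.trans hqr).le le_rfl
  set A : ℝ≥0 := M.toNNReal
  have hA : ∀ k, ‖u k‖ₑ ≤ A := fun k => by
    rw [← ofReal_norm]
    exact ENNReal.ofReal_le_ofReal (hM k)
  obtain ⟨θ, hθ0, hθ1, hθ⟩ := exists_interpolation_exponent hp0 hpq
    (show (q : ℝ≥0∞) < r by exact_mod_cast hqr)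
  obtain ⟨τ, hτ0, hτ1, hτ⟩ := exists_interpolation_exponent hp0 hpq
    (show (q : ℝ≥0∞) < ⊤ from ENNReal.coe_lt_top)
  have hloc := fun k => locallyIntegrable_coeFn_Lp (sobolevFun (u k))
  have hgloc := fun k => locallyIntegrable_coeFn_Lp (sobolevGrad (u k))
  have hmeas : ∀ (ρ : ContDiffBump (0 : EuclideanSpace ℝ (Fin N))) k,
      AEStronglyMeasurable (ρ.mollify volume (sobolevFun (u k))) volume := fun ρ k =>
    (ρ.contDiff_mollify (hloc k)).continuous.aestronglyMeasurable
  have herr : ∀ (ρ : ContDiffBump (0 : EuclideanSpace ℝ (Fin N))) k,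
      eLpNorm (fun x => ρ.mollify volume (sobolevFun (u k)) x - sobolevFun (u k) x) q volume ≤
        (ENNReal.ofReal ρ.rOut * A) ^ (1 - θ) * (2 * (C * A)) ^ θ := by
    intro ρ k
    refine (eLpNorm_le_eLpNorm_rpow_mul_eLpNorm_rpow hθ0 hθ1 hθ
      ((hmeas ρ k).sub (hloc k).aestronglyMeasurable)).trans ?_
    gcongr
    · refine ((isWeakGradient_sobolev (u k)).eLpNorm_mollify_sub_le hp (hloc k) (hgloc k) ρ).trans ?_
      gcongr
      exact (eLpNorm_sobolevGrad_le (u k)).trans (hA k)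
    · refine (eLpNorm_sub_le (hmeas ρ k) (hloc k).aestronglyMeasurable
        (by exact_mod_cast hr1)).trans ?_
      rw [two_mul]
      have h1 : eLpNorm (sobolevFun (u k)) r volume ≤ C * A :=
        (hC (u k)).trans (by gcongr; exact hA k)
      exact add_le_add ((ρ.eLpNorm_mollify_le hr1 (hloc k).aestronglyMeasurable).trans h1) h1
  have herr0 : Tendsto (fun n => (ENNReal.ofReal (ContDiffBump.shrinking
      (EuclideanSpace ℝ (Fin N)) n).rOut * A) ^ (1 - θ) * (2 * (C * A : ℝ≥0∞)) ^ θ) atTop (𝓝 0) := by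
    have h1 := ENNReal.tendsto_ofReal
      (ContDiffBump.tendsto_rOut_shrinking (EuclideanSpace ℝ (Fin N)))
    have h2 := ENNReal.Tendsto.mul_const (b := (A : ℝ≥0∞)) h1 (Or.inr ENNReal.coe_ne_top)
    have h3 := h2.ennrpow_const (1 - θ)
    have h4 := ENNReal.Tendsto.mul_const (b := (2 * (C * A : ℝ≥0∞)) ^ θ) h3
      (Or.inr (ENNReal.rpow_ne_top_of_nonneg hθ0.le (by finiteness)))
    simpa [ENNReal.zero_rpow_of_pos (by linarith : (0 : ℝ) < 1 - θ)] using h4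
  rw [ENNReal.tendsto_nhds_zero]
  intro ε hε
  have hε2 : 0 < ε / 2 := ENNReal.half_pos hε.ne'
  obtain ⟨n, hn⟩ := ((ENNReal.tendsto_nhds_zero.1 herr0) (ε / 2) hε2).exists
  set ρ := ContDiffBump.shrinking (EuclideanSpace ℝ (Fin N)) n
  have hsup : Tendsto (fun δ : ℝ => (A : ℝ≥0∞) ^ (1 - τ) * ENNReal.ofReal δ ^ τ) (𝓝[>] 0)
      (𝓝 0) := by
    have h1 : Tendsto (fun δ : ℝ => ENNReal.ofReal δ) (𝓝[>] 0) (𝓝 0) := by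
      simpa using (ENNReal.continuous_ofReal.tendsto 0).mono_left nhdsWithin_le_nhds
    have h2 := ENNReal.Tendsto.const_mul (a := (A : ℝ≥0∞) ^ (1 - τ)) (h1.ennrpow_const τ)
      (Or.inr (ENNReal.rpow_ne_top_of_nonneg (by linarith) ENNReal.coe_ne_top))
    simpa [ENNReal.zero_rpow_of_pos hτ0] using h2
  obtain ⟨δ, hδ, hδ0⟩ := ((ENNReal.tendsto_nhds_zero.1 hsup (ε / 2) hε2).and
    self_mem_nhdsWithin).exists
  filter_upwards [hu.eventually_mollify_le hM ρ hδ0] with k hk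
  have e1 : eLpNorm (ρ.mollify volume (sobolevFun (u k))) q volume ≤ ε / 2 := by
    refine (eLpNorm_le_eLpNorm_rpow_mul_eLpNorm_rpow hτ0 hτ1 hτ (hmeas ρ k)).trans
      (le_trans ?_ hδ)
    gcongr
    · exact (ρ.eLpNorm_mollify_le hp (hloc k).aestronglyMeasurable).trans
        ((eLpNorm_sobolevFun_le (u k)).trans (hA k))
    · rw [eLpNorm_exponent_top]
      exact eLpNormEssSup_le_of_ae_bound (Eventually.of_forall hk)
  calc eLpNorm (sobolevFun (u k)) q volume
      = eLpNorm (ρ.mollify volume (sobolevFun (u k)) -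
          fun x => ρ.mollify volume (sobolevFun (u k)) x - sobolevFun (u k) x) q volume := by
        congr 1
        ext x
        simp
    _ ≤ ε / 2 + ε / 2 := (eLpNorm_sub_le (hmeas ρ k)
        ((hmeas ρ k).sub (hloc k).aestronglyMeasurable) hq1).trans
        (add_le_add e1 ((herr ρ k).trans hn))
    _ = ε := ENNReal.add_halves ε

end Cocompactness

section Scaling

theorem eLpNorm_comp_smul {E F : Type*} [NormedAddCommGroup E] [NormedSpace ℝ E]
    [FiniteDimensional ℝ E] [MeasurableSpace E] [BorelSpace E] {μ : Measure E}
    [μ.IsAddHaarMeasure] [NormedAddCommGroup F] {w : E → F} (hw : Continuous w) (s : ℝ≥0)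
    {l : ℝ} (hl : 0 < l) :
    eLpNorm (fun x => w (l • x)) s μ =
      ENNReal.ofReal (l ^ (-(Module.finrank ℝ E / s : ℝ))) * eLpNorm w s μ := by
  have h := eLpNorm_map_measure (μ := μ) (f := fun x : E => l • x) (g := w) (p := (s : ℝ≥0∞))
    hw.aestronglyMeasurable (continuous_const_smul l).aemeasurable
  rw [Measure.map_addHaar_smul μ hl.ne'] at h
  refine Eq.trans h.symm ?_
  rw [abs_of_pos (by positivity), eLpNorm_smul_measure_of_ne_zero
    (by simpa using pow_pos hl _), smul_eq_mul]
  congr 1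
  rw [ENNReal.ofReal_rpow_of_nonneg (by positivity) ENNReal.toReal_nonneg, ← Real.rpow_natCast,
    ← Real.rpow_neg hl.le, ← Real.rpow_mul hl.le]
  congr 2
  simp
  ring

variable {N : ℕ} {p : ℝ≥0} [Fact (1 ≤ (p : ℝ≥0∞))]

/-- Compactly supported `C^1` functions belong to the Sobolev space. -/
theorem exists_sobolevFun_ae_eq {v : EuclideanSpace ℝ (Fin N) → ℝ} (hv : ContDiff ℝ 1 v)
    (hs : HasCompactSupport v) : ∃ U : SobolevW1 N p, sobolevFun U =ᵐ[volume] v ∧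
      ‖U‖ₑ ≤ eLpNorm v p volume + eLpNorm (fderiv ℝ v) p volume := by
  have hg : gradient v = fun x => (InnerProductSpace.toDual ℝ _).symm (fderiv ℝ v x) := rfl
  have hgc : Continuous (gradient v) := by
    rw [hg]
    exact (LinearIsometryEquiv.continuous _).comp (hv.continuous_fderiv one_ne_zero)
  have hgs : HasCompactSupport (gradient v) := by
    rw [hg]
    exact (hs.fderiv ℝ).comp_left (map_zero _)
  have m1 : MemLp v p volume := hv.continuous.memLp_of_hasCompactSupport hs
  have m2 : MemLp (gradient v) p volume := hgc.memLp_of_hasCompactSupport hgs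
  let W : SobolevAmbient N p := WithLp.toLp p (m1.toLp v, m2.toLp (gradient v))
  have hW : IsWeakGradient N W.fst W.snd := by
    intro φ hφ hφs i
    refine Eq.trans ?_ ((isWeakGradient_of_contDiff hv φ hφ hφs i).trans ?_)
    · refine integral_congr_ae ?_
      filter_upwards [m1.coeFn_toLp] with x hx
      rw [← hx]
      rfl
    · refine congrArg Neg.neg (integral_congr_ae ?_)
      filter_upwards [m2.coeFn_toLp] with x hx
      rw [← hx]
      rfl
  refine ⟨⟨W, hW⟩, m1.coeFn_toLp, ?_⟩
  have e : W = WithLp.toLp p (m1.toLp v, 0) + WithLp.toLp p (0, m2.toLp (gradient v)) := by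
    apply (WithLp.equiv (p : ℝ≥0∞) _).injective
    exact Prod.ext (add_zero _).symm (zero_add _).symm
  have h1 : ‖W‖ₑ ≤ eLpNorm v p volume + eLpNorm (gradient v) p volume := by
    rw [e]
    refine (enorm_add_le _ _).trans_eq ?_
    rw [enorm_eq_nnnorm, enorm_eq_nnnorm, WithLp.nnnorm_toLp_inl, WithLp.nnnorm_toLp_inr,
      ← enorm_eq_nnnorm, ← enorm_eq_nnnorm, Lp.enorm_toLp, Lp.enorm_toLp]
  refine h1.trans_eq ?_
  congr 1
  refine eLpNorm_congr_norm_ae (Eventually.of_forall fun x => ?_)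
  rw [hg]
  exact LinearIsometryEquiv.norm_map _ _

/-- Rescalings of a test function, with their `L^s` norms. -/
theorem exists_sobolevFun_rescale {φ : EuclideanSpace ℝ (Fin N) → ℝ} (hφ : ContDiff ℝ 1 φ)
    (hs : HasCompactSupport φ) {l : ℝ} (hl : 0 < l) (σ : ℝ) :
    ∃ U : SobolevW1 N p,
      (∀ s : ℝ≥0, eLpNorm (sobolevFun U) s volume =
        ENNReal.ofReal (l ^ (σ - N / s)) * eLpNorm φ s volume) ∧
      ‖U‖ₑ ≤ ENNReal.ofReal (l ^ (σ - N / p)) * eLpNorm φ p volume +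
        ENNReal.ofReal (l ^ (σ + 1 - N / p)) * eLpNorm (fderiv ℝ φ) p volume := by
  have hcomp : ContDiff ℝ 1 fun x => φ (l • x) := hφ.comp (by fun_prop)
  obtain ⟨U, hU, hn⟩ := exists_sobolevFun_ae_eq (p := p) (v := l ^ σ • fun x => φ (l • x))
    (hcomp.const_smul (l ^ σ)) ((hs.comp_homeomorph (Homeomorph.smulOfNeZero l hl.ne')).smul_left
      (f := fun _ => l ^ σ))
  have key : ∀ {F : Type} [NormedAddCommGroup F] [NormedSpace ℝ F]
      {w : EuclideanSpace ℝ (Fin N) → F}, Continuous w → ∀ (α : ℝ) (s : ℝ≥0),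
      eLpNorm (l ^ α • fun x => w (l • x)) s volume =
        ENNReal.ofReal (l ^ (α - N / s)) * eLpNorm w s volume := by
    intro F _ _ w hw α s
    rw [eLpNorm_const_smul, eLpNorm_comp_smul hw s hl, ← mul_assoc,
      Real.enorm_of_nonneg (by positivity), ← ENNReal.ofReal_mul (by positivity),
      ← Real.rpow_add hl, finrank_euclideanSpace_fin, sub_eq_add_neg]
  refine ⟨U, fun s => (eLpNorm_congr_ae hU).trans (key hφ.continuous σ s), hn.trans ?_⟩
  have hfd : fderiv ℝ (l ^ σ • fun x => φ (l • x)) =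
      l ^ (σ + 1) • fun x => fderiv ℝ φ (l • x) := by
    ext1 x
    have h1 : HasFDerivAt (fun x => φ (l • x)) _ x :=
      ((hφ.differentiable one_ne_zero (l • x)).hasFDerivAt).comp x
        ((ContinuousLinearMap.id ℝ (EuclideanSpace ℝ (Fin N))).hasFDerivAt.const_smul l)
    rw [(h1.const_smul (l ^ σ)).fderiv, Pi.smul_apply, ContinuousLinearMap.comp_smul,
      ContinuousLinearMap.comp_id, smul_smul, Real.rpow_add_one hl.ne']
  rw [hfd, key hφ.continuous σ p, key (hφ.continuous_fderiv one_ne_zero) (σ + 1) p]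

/-- A rescaling that preserves the `L^q` norm, keeps the Sobolev norm bounded and makes some other
`L^t` norm vanish shows that the imbedding into `L^q` is not cocompact. -/
theorem not_isCocompactImbedding_of_rescale (hp : 1 < p) {q r t : ℝ≥0} [Fact (1 ≤ (q : ℝ≥0∞))]
    (hN : 0 < N) (hr : (r : ℝ)⁻¹ = (p : ℝ)⁻¹ - (N : ℝ)⁻¹) (hpt : p ≤ t) (htr : t ≤ r)
    {ι : SobolevW1 N p →L[ℝ] Lp ℝ q (volume : Measure (EuclideanSpace ℝ (Fin N)))}
    (hι : ∀ u, ι u =ᵐ[volume] sobolevFun u) {l : ℕ → ℝ} (hl : ∀ k, 0 < l k)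
    (h0 : Tendsto (fun k => l k ^ ((N : ℝ) / q - N / t)) atTop (𝓝 0))
    (h1 : ∀ k, l k ^ ((N : ℝ) / q - N / p) ≤ 1) (h2 : ∀ k, l k ^ ((N : ℝ) / q + 1 - N / p) ≤ 1) :
    ¬ IsCocompactImbedding (latticeShifts N (p : ℝ≥0∞)) ι := by
  intro hco
  let φ : ContDiffBump (0 : EuclideanSpace ℝ (Fin N)) := ⟨1, 2, one_pos, one_lt_two⟩
  have hφ : ContDiff ℝ 1 φ := φ.contDiff
  have hφs := φ.hasCompactSupport
  have hfs : ∀ s : ℝ≥0, eLpNorm φ s volume ≠ ⊤ := fun s =>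
    (hφ.continuous.memLp_of_hasCompactSupport hφs).eLpNorm_ne_top
  have hfd : eLpNorm (fderiv ℝ φ) p volume ≠ ⊤ :=
    ((hφ.continuous_fderiv one_ne_zero).memLp_of_hasCompactSupport (hφs.fderiv ℝ)).eLpNorm_ne_top
  have hq0 : 0 < q := zero_lt_one.trans_le (one_le_of_fact q)
  choose U hU hn using fun k =>
    exists_sobolevFun_rescale (p := p) hφ hφs (hl k) ((N : ℝ) / q)
  have hbd : Bornology.IsBounded (Set.range U) := by
    refine isBounded_iff_forall_norm_le.2
      ⟨(eLpNorm φ p volume + eLpNorm (fderiv ℝ φ) p volume).toReal, ?_⟩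
    rintro _ ⟨k, rfl⟩
    rw [← toReal_enorm]
    refine ENNReal.toReal_mono (ENNReal.add_ne_top.2 ⟨hfs p, hfd⟩) ((hn k).trans ?_)
    refine add_le_add (mul_le_of_le_one_left zero_le ?_) (mul_le_of_le_one_left zero_le ?_)
    · exact ENNReal.ofReal_le_one.2 (h1 k)
    · exact ENNReal.ofReal_le_one.2 (h2 k)
  have hUt : Tendsto (fun k => eLpNorm (sobolevFun (U k)) t volume) atTop (𝓝 0) := by
    simp only [fun k => hU k t]
    have := ENNReal.Tendsto.mul_const (b := eLpNorm φ t volume) (ENNReal.tendsto_ofReal h0)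
      (Or.inr (hfs t))
    simpa using this
  have hlim := hco U (gaugeWeakToZero_of_tendsto_eLpNorm hp hN hr hpt htr hbd hUt)
  rw [tendsto_norm_iff_tendsto_eLpNorm hι] at hlim
  simp only [fun k => hU k q, sub_self, Real.rpow_zero, ENNReal.ofReal_one, one_mul] at hlim
  have hz : eLpNorm φ q volume = 0 := tendsto_nhds_unique tendsto_const_nhds hlim
  rw [eLpNorm_eq_zero_iff hφ.continuous.aestronglyMeasurable (by simpa using hq0.ne')] at hz
  have hz' : (φ : EuclideanSpace ℝ (Fin N) → ℝ) = 0 :=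
    (hφ.continuous.ae_eq_iff_eq volume continuous_zero).1 hz
  have h3 : φ 0 = 1 := φ.one_of_mem_closedBall (by simp [φ])
  rw [hz'] at h3
  exact zero_ne_one h3

end Scaling

theorem theorem2p1 (N : ℕ) (p q : ℝ≥0) [Fact (1 ≤ (p : ℝ≥0∞))] [Fact (1 ≤ (q : ℝ≥0∞))]
    (hp : 1 < p) (hpN : (p : ℝ) < N)
    (hpq : p ≤ q) (hq : (q : ℝ) ≤ p * N / (N - p)) :
    IsGaugeSet (latticeShifts N (p : ℝ≥0∞)) ∧
    ∃ ι : SobolevW1 N (p : ℝ≥0∞) →L[ℝ]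
        Lp ℝ (q : ℝ≥0∞) (volume : Measure (EuclideanSpace ℝ (Fin N))),
      (∀ u, ι u =ᵐ[volume] sobolevFun u) ∧
      Function.Injective ι ∧
      (IsCocompactImbedding (latticeShifts N (p : ℝ≥0∞)) ι ↔
        q ≠ p ∧ (q : ℝ) ≠ p * N / (N - p)) ∧
      (q ≠ p → (q : ℝ) ≠ p * N / (N - p) →
        IsLocalMetrization (latticeShifts N (p : ℝ≥0∞)) ι) := by
  have hp0 : (0 : ℝ) < p := by exact_mod_cast zero_lt_one.trans hp
  have hN0 : (0 : ℝ) < N := hp0.trans hpN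
  have hN : 0 < N := by exact_mod_cast hN0
  have hNp : (0 : ℝ) < N - p := sub_pos.2 hpN
  obtain ⟨r, hrdef⟩ : ∃ r : ℝ≥0, (r : ℝ) = p * N / (N - p) :=
    ⟨⟨_, by positivity⟩, rfl⟩
  rw [← hrdef] at hq ⊢
  have hr : (r : ℝ)⁻¹ = (p : ℝ)⁻¹ - (N : ℝ)⁻¹ := by
    rw [hrdef]
    field_simp
  have hqr : q ≤ r := by exact_mod_cast hq
  obtain ⟨ι, hι⟩ := exists_sobolev_embedding (N := N) (p := p) (q := q) hN hr hpq hqr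
  have hforward : q ≠ p → (q : ℝ) ≠ r → ∀ u : ℕ → SobolevW1 N p,
      GaugeWeakToZero (latticeShifts N (p : ℝ≥0∞)) u → Tendsto (fun k => ‖ι (u k)‖) atTop (𝓝 0) := by
    intro h1 h2 u hu
    rw [tendsto_norm_iff_tendsto_eLpNorm hι]
    exact hu.tendsto_eLpNorm hN hr (lt_of_le_of_ne hpq h1.symm)
      (lt_of_le_of_ne hqr fun h => h2 (by rw [h]))
  have hdiv : (N : ℝ) / r = N / p - 1 := by
    rw [div_eq_mul_inv, hr, mul_sub, mul_inv_cancel₀ hN0.ne', div_eq_mul_inv]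
  refine ⟨isGaugeSet_latticeShifts, ι, hι, injective_of_ae_eq_sobolevFun hι, ⟨fun hco => ⟨?_, ?_⟩,
    fun h => hforward h.1 h.2⟩, fun h1 h2 u hu => ⟨hforward h1 h2 u, fun h => ?_⟩⟩
  · rintro rfl
    refine not_isCocompactImbedding_of_rescale hp hN hr hqr le_rfl hι
      (l := fun k : ℕ => 1 / ((k : ℝ) + 1)) (fun k => by positivity) ?_ (fun k => by simp)
      (fun k => ?_) hco
    · rw [hdiv]
      simpa using tendsto_one_div_add_atTop_nhds_zero_nat (𝕜 := ℝ)
    · rw [add_sub_cancel_left, Real.rpow_one]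
      exact div_le_one_of_le₀ (by linarith [(Nat.cast_nonneg k : (0 : ℝ) ≤ k)]) (by positivity)
  · intro h
    obtain rfl : q = r := by exact_mod_cast h
    refine not_isCocompactImbedding_of_rescale hp hN hr le_rfl hpq hι
      (l := fun k : ℕ => (k : ℝ) + 1) (fun k => by positivity) ?_ (fun k => ?_) (fun k => ?_) hco
    · rw [hdiv]
      simpa [Real.rpow_neg_one] using tendsto_one_div_add_atTop_nhds_zero_nat (𝕜 := ℝ)
    · rw [hdiv, sub_sub_cancel_left, Real.rpow_neg_one]
      exact inv_le_one_of_one_le₀ (by linarith [(Nat.cast_nonneg k : (0 : ℝ) ≤ k)])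
    · rw [hdiv]
      simp
  · rw [tendsto_norm_iff_tendsto_eLpNorm hι] at h
    exact gaugeWeakToZero_of_tendsto_eLpNorm hp hN hr hpq hqr hu h
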